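/- Let $G$ be a finite connected simple graph and let $\varphi$ be a complex unit gain function on $G$: it assigns to every oriented edge $e_{uv}$ (an edge $uv\in E(G)$ directed from $u$ to $v$) a complex number of modulus $1$, with $\varphi(e_{vu})=\varphi(e_{uv})^{-1}$. Let $A(G^{\varphi})$ be the Hermitian matrix indexed by $V(G)$ with entry $\varphi(e_{uv})$ at $(u,v)$ if $uv\in E(G)$ and $0$ otherwise, and let $p(G^{\varphi})$ be the number of its positive eigenvalues, counted with multiplicity. For a finite graph $H$ let $m(H)$ be its matching number (the maximum number of pairwise non-adjacent edges), and let $c(G)=|E(G)|-|V(G)|+\omega(G)$ be the cyclomatic number of $G$, where $\omega(G)$ is the number of connected components (so here $\omega(G)=1$). Let $O(G)$ be the set of vertices that lie on some cycle of $G$, and let $G-O(G)$ be the subgraph of $G$ induced on the remaining vertices. When the cycles of $G$ are pairwise vertex-disjoint, let $T_G$ be the graph obtained from $G$ by contracting each cycle to a single vertex. For a cycle $C=v_1v_2\cdots v_nv_1$ of $G$ put $\varphi(C)=\varphi(e_{v_1v_2})\varphi(e_{v_2v_3})\cdots\varphi(e_{v_{n-1}v_n})\varphi(e_{v_nv_1})$;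 the cycle $C$ is said to be of Type C if $n$ is odd and $\mathrm{Re}\left((-1)^{(n-1)/2}\varphi(C)\right)>0$ (this does not depend on the starting vertex or on the direction of traversal). Then $p(G^{\varphi})=m(G)+c(G)$ if and only if the following three conditions all hold: (a) any two distinct cycles of $G$ have no common vertex; (b) every cycle of $G$ is of Type C; (c) $m(T_G)=m(G-O(G))$. -/

import Mathlib

namespace SimpleGraph

/-- The matching number `m(G)`: the largest number of edges of a matching of `G`.
For a finite graph the set below is non-empty (empty matching) and bounded by the number of edges,
so the supremum is a maximum. -/
noncomputable def matchingNumber {V : Type*} (G : SimpleGraph V) : ℕ :=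
  sSup {k : ℕ | ∃ M : G.Subgraph, M.IsMatching ∧ M.edgeSet.ncard = k}

/-- The cyclomatic number `c(G) = |E(G)| - |V(G)| + ω(G)` of a finite graph, where `ω(G)` is the
number of connected components, computed in `ℤ`. -/
noncomputable def cyclomaticNumber {V : Type*} (G : SimpleGraph V) : ℤ :=
  (Nat.card G.edgeSet : ℤ) - (Nat.card V : ℤ) + (Nat.card G.ConnectedComponent : ℤ)

/-- Any two distinct cycles of `G` share no common vertex. A cycle is given by a closed walk that
goes once around it; two such walks describe the same cycle when they span the same subgraph. -/
def PairwiseDisjointCycles {V : Type*} (G : SimpleGraph V) : Prop :=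
  ∀ (u v : V) (C : G.Walk u u) (D : G.Walk v v), C.IsCycle → D.IsCycle →
    C.toSubgraph ≠ D.toSubgraph → Disjoint C.toSubgraph.verts D.toSubgraph.verts

/-- `O(G)`: the set of vertices that lie on some cycle of `G`. -/
def cycleVertices {V : Type*} (G : SimpleGraph V) : Set V :=
  {v | ∃ (u : V) (C : G.Walk u u), C.IsCycle ∧ v ∈ C.support}

/-- The identification of vertices made by contracting every cycle of `G` to a point: the
equivalence relation generated by `lying on a common cycle`. -/
def cycleSetoid {V : Type*} (G : SimpleGraph V) : Setoid V :=
  Relation.EqvGen.setoid fun v w =>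
    ∃ (u : V) (C : G.Walk u u), C.IsCycle ∧ v ∈ C.support ∧ w ∈ C.support

/-- `T_G`: the simple graph obtained from `G` by contracting each cycle of `G` to a vertex. Its
vertices are the classes of `G.cycleSetoid`; distinct classes are adjacent when some edge of `G`
joins them. -/
def contractCycles {V : Type*} (G : SimpleGraph V) : SimpleGraph (Quotient G.cycleSetoid) :=
  G.map (Quotient.mk G.cycleSetoid)

end SimpleGraph

/-- A complex unit gain function on `G`: a unit complex number for every oriented edge, such that
reversing the orientation inverts the value. -/
structure UnitGain {V : Type*} (G : SimpleGraph V) where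
  gain : G.Dart → Circle
  gain_symm : ∀ e : G.Dart, gain e.symm = (gain e)⁻¹

namespace UnitGain

open Classical in
/-- The adjacency matrix `A(G^φ)`: the entry at `(u, v)` is the gain of the oriented edge from `u`
to `v` if `u` and `v` are adjacent, and `0` otherwise. -/
noncomputable def adjMatrix {V : Type*} {G : SimpleGraph V} (φ : UnitGain G) : Matrix V V ℂ :=
  Matrix.of fun u v => if h : G.Adj u v then (φ.gain ⟨(u, v), h⟩ : ℂ) else 0

theorem isHermitian_adjMatrix {V : Type*} {G : SimpleGraph V} (φ : UnitGain G) :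
    φ.adjMatrix.IsHermitian := by
  ext u v
  by_cases h : G.Adj u v
  · have key : φ.gain ⟨(v, u), h.symm⟩ = (φ.gain ⟨(u, v), h⟩)⁻¹ :=
      φ.gain_symm ⟨(u, v), h⟩
    simp only [adjMatrix, Matrix.conjTranspose_apply, Matrix.of_apply, h, h.symm, dif_pos, key]
    rw [Circle.coe_inv_eq_conj]
    exact Complex.conj_conj _
  · have h' : ¬ G.Adj v u := fun k => h k.symm
    simp [adjMatrix, h, h']

/-- The positive inertia index `p(G^φ)`: the number of positive eigenvalues of `A(G^φ)`, counted
with multiplicity. -/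
noncomputable def positiveInertia {V : Type*} [Fintype V] [DecidableEq V] {G : SimpleGraph V}
    (φ : UnitGain G) : ℕ :=
  Nat.card {i : V // 0 < φ.isHermitian_adjMatrix.eigenvalues i}

/-- The gain of a walk: the product of the gains of its successive oriented edges. -/
noncomputable def walkGain {V : Type*} {G : SimpleGraph V} (φ : UnitGain G) {u v : V}
    (C : G.Walk u v) : ℂ :=
  (C.darts.map fun e => (φ.gain e : ℂ)).prod

/-- A cycle of length `n` is of Type C if `n` is odd and `Re ((-1) ^ ((n - 1) / 2) * φ(C)) > 0`.
Reversing the direction in which the cycle is traversed conjugates `φ(C)`, so that the condition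
depends on the cycle only. -/
def IsTypeC {V : Type*} {G : SimpleGraph V} (φ : UnitGain G) {u : V} (C : G.Walk u u) : Prop :=
  Odd C.length ∧ 0 < ((-1 : ℂ) ^ ((C.length - 1) / 2) * φ.walkGain C).re

end UnitGain

/-! By `Matrix.IsHermitian.card_pos_eigenvalues`, p(G^φ) is the largest dimension of a subspace on
which the Hermitian form is positive definite, so estimates reduce to linear conditions and test
subspaces. If a vertex cover K exists, the form vanishes where the coordinates in K vanish, so p ≤
|K|. Putting one vertex of a cycle into K lowers c by at least one, and König's theorem handles the
remaining forest; hence p ≤ m + c (`exists_cover_card_le`, `posIndex_energy_le`).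

Suppose equality holds. Isolating a cycle vertex x lowers p by at most 1 and c by at least 1, so
equality persists, m is unchanged and c drops by exactly 1 (`IsTight.isolate_of_mem_cycle`).
Distinct cycles that met would make c drop by 2 at a suitable vertex, which gives (a). Some maximum
matching misses x, so the other end y of a bridge xy is covered by every maximum matching, and y can
be isolated with equality preserved (`IsTight.isolate_of_bridge`). Stripping the neighbours of a
cycle C in this way leaves C as a component with p(C) > m(C). Eliminating two vertices of a cycle at
a time shows that this means Type C, which gives (b). Counting the cycle vertices against a maximum
matching that avoids c of them shows that no edge of this matching leaves a cycle, which gives (c)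
(`IsTight.matchingNumber_contractCycles_le`).

Conversely, T_G is a forest. Under (c), a minimum cover of T_G has as many vertices as a maximum
matching of G - O(G), so it contains no contracted cycle and lifts to a set K off the cycles that
meets every edge not on a cycle. The forest G - O(G) has index at least |K| for both signs of its
form, so the rows in K are independent on columns off the cycles and outside K (`exists_rows_eq`).
These rows give |K| hyperbolic planes next to the form of the cycles
(`posIndex_energy_add_card_le`). Disjoint Type C cycles attain m + c for their union, and m(G)
exceeds the matching number of that union by at most |K|. -/

/-! ### Positive index of a form -/

/-- The positive index of a real-valued function on a complex vector space: the largest dimension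
of a subspace on which the function is positive away from `0`. -/
noncomputable def posIndex {E : Type*} [AddCommGroup E] [Module ℂ E] (Q : E → ℝ) : ℕ :=
  sSup {k | ∃ W : Submodule ℂ E, Module.finrank ℂ W = k ∧ ∀ w ∈ W, w ≠ 0 → 0 < Q w}

section posIndex

variable {E E₁ E₂ : Type*} [AddCommGroup E] [Module ℂ E] [FiniteDimensional ℂ E]
  [AddCommGroup E₁] [Module ℂ E₁] [FiniteDimensional ℂ E₁]
  [AddCommGroup E₂] [Module ℂ E₂] [FiniteDimensional ℂ E₂]

theorem posIndex_bddAbove (Q : E → ℝ) :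
    BddAbove {k | ∃ W : Submodule ℂ E, Module.finrank ℂ W = k ∧ ∀ w ∈ W, w ≠ 0 → 0 < Q w} := by
  refine ⟨Module.finrank ℂ E, ?_⟩
  rintro k ⟨W, rfl, -⟩
  exact W.finrank_le

theorem exists_finrank_eq_posIndex (Q : E → ℝ) :
    ∃ W : Submodule ℂ E, Module.finrank ℂ W = posIndex Q ∧ ∀ w ∈ W, w ≠ 0 → 0 < Q w := by
  have := Nat.sSup_mem (s := {k | ∃ W : Submodule ℂ E, Module.finrank ℂ W = k ∧
    ∀ w ∈ W, w ≠ 0 → 0 < Q w}) ⟨0, ⊥, by simp, by simp⟩ (posIndex_bddAbove Q)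
  exact this

theorem finrank_le_posIndex {Q : E → ℝ} (W : Submodule ℂ E) (h : ∀ w ∈ W, w ≠ 0 → 0 < Q w) :
    Module.finrank ℂ W ≤ posIndex Q :=
  le_csSup (posIndex_bddAbove Q) ⟨W, rfl, h⟩

/-- The conditions `r w = 0` cut a maximal positive subspace down by at most `Fintype.card ι`
dimensions. On what remains `Q₁ ∘ T` is positive away from 0, and with `Q₁ 0 ≤ 0` this makes `T`
injective there. -/
theorem posIndex_le_add_card {ι : Type*} [Fintype ι] {Q : E → ℝ} {Q₁ : E₁ → ℝ}
    (r : E →ₗ[ℂ] (ι → ℂ)) (T : E →ₗ[ℂ] E₁) (h0 : Q₁ 0 ≤ 0)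
    (h : ∀ w, r w = 0 → Q w ≤ Q₁ (T w)) : posIndex Q ≤ posIndex Q₁ + Fintype.card ι := by
  obtain ⟨W, hW, hpos⟩ := exists_finrank_eq_posIndex Q
  set g : W →ₗ[ℂ] (ι → ℂ) := r.domRestrict W with hg
  set f : LinearMap.ker g →ₗ[ℂ] E₁ := T ∘ₗ W.subtype ∘ₗ (LinearMap.ker g).subtype with hf
  have key : ∀ x : LinearMap.ker g, x ≠ 0 → 0 < Q₁ (f x) := by
    rintro ⟨⟨x, hx⟩, hk⟩ hne
    have hx0 : x ≠ 0 := by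
      rintro rfl; exact hne rfl
    exact (hpos x hx hx0).trans_le (h x hk)
  have hinj : Function.Injective f := by
    rw [← LinearMap.ker_eq_bot, LinearMap.ker_eq_bot']
    intro x hx
    by_contra hne
    have := key x hne
    rw [hx] at this
    linarith
  have h1 : Module.finrank ℂ (LinearMap.range f) ≤ posIndex Q₁ := by
    apply finrank_le_posIndex
    rintro _ ⟨x, rfl⟩ hne
    exact key x (by rintro rfl; exact hne (map_zero f))
  rw [LinearMap.finrank_range_of_inj hinj] at h1
  have h2 := g.finrank_range_add_finrank_ker
  have h3 : Module.finrank ℂ (LinearMap.range g) ≤ Fintype.card ι := by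
    simpa using (LinearMap.range g).finrank_le
  omega

theorem posIndex_le_of_le {Q : E → ℝ} {Q₁ : E₁ → ℝ} (T : E →ₗ[ℂ] E₁) (h0 : Q₁ 0 ≤ 0)
    (h : ∀ w, Q w ≤ Q₁ (T w)) : posIndex Q ≤ posIndex Q₁ := by
  simpa using posIndex_le_add_card (ι := Empty) 0 T h0 fun w _ => h w

theorem posIndex_eq_zero {Q : E → ℝ} (h : ∀ w, Q w ≤ 0) : posIndex Q = 0 := by
  obtain ⟨W, hW, hpos⟩ := exists_finrank_eq_posIndex Q
  rw [← hW]
  have : W = ⊥ := by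
    rw [Submodule.eq_bot_iff]
    intro w hw
    by_contra hne
    exact absurd (hpos w hw hne) (not_lt.2 (h w))
  subst this
  simp

theorem posIndex_le_card {ι : Type*} [Fintype ι] {Q : E → ℝ} (r : E →ₗ[ℂ] (ι → ℂ))
    (h : ∀ w, r w = 0 → Q w ≤ 0) : posIndex Q ≤ Fintype.card ι := by
  have := posIndex_le_add_card (Q₁ := fun _ : E => (0 : ℝ)) r LinearMap.id le_rfl h
  rwa [posIndex_eq_zero (fun _ => le_rfl), zero_add] at this

/-- A product of maximal positive subspaces is positive for the sum of the two forms. Injectivity of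
`T` need not be assumed: positivity together with `Q 0 ≤ 0` forces it on that product. -/
theorem posIndex_add_le {Q : E → ℝ} {Q₁ : E₁ → ℝ} {Q₂ : E₂ → ℝ} (T : E₁ × E₂ →ₗ[ℂ] E)
    (h0 : Q 0 ≤ 0) (h1 : Q₁ 0 = 0) (h2 : Q₂ 0 = 0)
    (h : ∀ x y, Q₁ x + Q₂ y ≤ Q (T (x, y))) : posIndex Q₁ + posIndex Q₂ ≤ posIndex Q := by
  obtain ⟨W₁, hW₁, hpos₁⟩ := exists_finrank_eq_posIndex Q₁
  obtain ⟨W₂, hW₂, hpos₂⟩ := exists_finrank_eq_posIndex Q₂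
  have hp : posIndex (fun z : E₁ × E₂ => Q₁ z.1 + Q₂ z.2) ≤ posIndex Q :=
    posIndex_le_of_le T h0 fun z => h z.1 z.2
  refine le_trans ?_ hp
  set f : (W₁ × W₂) →ₗ[ℂ] E₁ × E₂ := LinearMap.prodMap W₁.subtype W₂.subtype with hf
  have hinj : Function.Injective f := W₁.injective_subtype.prodMap W₂.injective_subtype
  have hle := finrank_le_posIndex (Q := fun z : E₁ × E₂ => Q₁ z.1 + Q₂ z.2) (LinearMap.range f) (by
    rintro _ ⟨⟨⟨x, hx⟩, ⟨y, hy⟩⟩, rfl⟩ hne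
    change 0 < Q₁ x + Q₂ y
    by_cases hx0 : x = 0
    · subst hx0
      have hy0 : y ≠ 0 := by rintro rfl; exact hne rfl
      have := hpos₂ y hy hy0
      linarith
    · have h3 := hpos₁ x hx hx0
      by_cases hy0 : y = 0
      · subst hy0; linarith
      · have := hpos₂ y hy hy0
        linarith)
  rwa [LinearMap.finrank_range_of_inj hinj, Module.finrank_prod, hW₁, hW₂] at hle

theorem posIndex_pos_def {Q : E → ℝ} (h : ∀ w, w ≠ 0 → 0 < Q w) :
    posIndex Q = Module.finrank ℂ E := by
  apply le_antisymm
  · obtain ⟨W, hW, -⟩ := exists_finrank_eq_posIndex Q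
    exact hW ▸ W.finrank_le
  · simpa using finrank_le_posIndex (Q := Q) ⊤ fun w _ => h w

/-- The positive index of a diagonal form is the number of its positive coefficients. -/
theorem posIndex_diagonal {ι : Type*} [Fintype ι] (c : ι → ℝ) :
    posIndex (fun z : ι → ℂ => ∑ i, c i * ‖z i‖ ^ 2) = Nat.card {i // 0 < c i} := by
  classical
  rw [Nat.card_eq_fintype_card]
  apply le_antisymm
  · apply posIndex_le_card (LinearMap.funLeft ℂ ℂ (Subtype.val : {i // 0 < c i} → ι))
    intro w hw
    apply Finset.sum_nonpos
    intro i _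
    by_cases hi : 0 < c i
    · have := congrFun hw ⟨i, hi⟩
      simp only [LinearMap.funLeft_apply, Pi.zero_apply] at this
      simp [this]
    · exact mul_nonpos_of_nonpos_of_nonneg (not_lt.1 hi) (by positivity)
  · have h1 : posIndex (fun z : {i // 0 < c i} → ℂ => ∑ i : {i // 0 < c i}, c i * ‖z i‖ ^ 2) =
        Fintype.card {i // 0 < c i} := by
      rw [posIndex_pos_def, Module.finrank_fintype_fun_eq_card]
      intro w hw
      obtain ⟨i, hi⟩ := Function.ne_iff.1 hw
      refine Finset.sum_pos' (fun j _ => mul_nonneg j.2.le (by positivity)) ⟨i, Finset.mem_univ i, ?_⟩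
      exact mul_pos i.2 (pow_pos (norm_pos_iff.2 hi) 2)
    rw [← h1]
    refine posIndex_le_of_le (Function.ExtendByZero.linearMap ℂ
      (Subtype.val : {i // 0 < c i} → ι)) (by simp) ?_
    intro w
    have h2 : ∀ i : {i // 0 < c i}, Function.extend Subtype.val w (0 : ι → ℂ) i = w i := fun i =>
      Subtype.val_injective.extend_apply _ _ _
    have h3 : ∑ i : {i // 0 < c i}, c i * ‖w i‖ ^ 2 = ∑ i ∈ Finset.univ.filter (fun i => 0 < c i),
        c i * ‖Function.extend Subtype.val w (0 : ι → ℂ) i‖ ^ 2 := by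
      rw [← Finset.sum_subtype_eq_sum_filter, Finset.subtype_univ]
      exact Finset.sum_congr rfl fun i _ => by rw [h2]
    rw [h3, Finset.sum_filter]
    apply Finset.sum_le_sum
    intro i _
    split_ifs with hi
    · exact le_rfl
    · have : Function.extend Subtype.val w (0 : ι → ℂ) i = 0 :=
        Function.extend_apply' _ _ _ (by rintro ⟨a, rfl⟩; exact hi a.2)
      simp [this]

end posIndex

/-- In coordinates along an orthonormal eigenbasis the form is diagonal with the eigenvalues as
coefficients, so `posIndex_diagonal` counts the positive ones. -/
theorem Matrix.IsHermitian.card_pos_eigenvalues {n : Type*} [Fintype n] [DecidableEq n]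
    {A : Matrix n n ℂ} (hA : A.IsHermitian) :
    Nat.card {i // 0 < hA.eigenvalues i} =
      posIndex (fun w : n → ℂ => (star w ⬝ᵥ A.mulVec w).re) := by
  rw [← posIndex_diagonal]
  have key : ∀ w : n → ℂ, (star w ⬝ᵥ A.mulVec w).re =
      ∑ i, hA.eigenvalues i *
        ‖((star (hA.eigenvectorUnitary : Matrix n n ℂ)).mulVec w) i‖ ^ 2 := by
    intro w
    have hs := hA.spectral_theorem
    rw [Unitary.conjStarAlgAut_apply] at hs
    set U : Matrix n n ℂ := (hA.eigenvectorUnitary : Matrix n n ℂ)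
    have h1 : star w ⬝ᵥ A.mulVec w = star ((star U).mulVec w) ⬝ᵥ
        (Matrix.diagonal (RCLike.ofReal ∘ hA.eigenvalues)).mulVec ((star U).mulVec w) := by
      conv_lhs => rw [hs]
      rw [← Matrix.mulVec_mulVec, ← Matrix.mulVec_mulVec, Matrix.dotProduct_mulVec,
        Matrix.star_mulVec, Matrix.star_eq_conjTranspose, Matrix.conjTranspose_conjTranspose]
    rw [h1]
    simp only [dotProduct, Matrix.mulVec_diagonal, Pi.star_apply, Complex.re_sum]
    refine Finset.sum_congr rfl fun i _ => ?_
    generalize (star U).mulVec w i = z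
    simp only [Function.comp_apply, RCLike.star_def, Complex.coe_algebraMap, RCLike.ofReal]
    rw [← Complex.normSq_eq_norm_sq, Complex.normSq_apply]
    simp
    ring
  apply le_antisymm
  · refine posIndex_le_of_le (Matrix.mulVecLin (hA.eigenvectorUnitary : Matrix n n ℂ)) (by simp) ?_
    intro w
    rw [key]
    simp [Matrix.mulVec_mulVec]
  · refine posIndex_le_of_le (Matrix.mulVecLin (star (hA.eigenvectorUnitary : Matrix n n ℂ)))
      (by simp) ?_
    intro w
    rw [key]
    simp

/-! ### Matching numbers -/

namespace SimpleGraph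

variable {V W : Type*}

/-- A finite set of unordered pairs no two of which share an element. -/
def IsEdgeMatching (S : Finset (Sym2 V)) : Prop :=
  ∀ e ∈ S, ∀ f ∈ S, ∀ v, v ∈ e → v ∈ f → e = f

theorem IsEdgeMatching.subset {S T : Finset (Sym2 V)} (hT : IsEdgeMatching T) (h : S ⊆ T) :
    IsEdgeMatching S := fun e he f hf => hT e (h he) f (h hf)

section

variable [Finite V]

theorem matchingNumber_bddAbove (G : SimpleGraph V) :
    BddAbove {k : ℕ | ∃ M : G.Subgraph, M.IsMatching ∧ M.edgeSet.ncard = k} := by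
  refine ⟨(Set.univ : Set (Sym2 V)).ncard, ?_⟩
  rintro k ⟨M, -, rfl⟩
  exact Set.ncard_le_ncard (Set.subset_univ _) (Set.toFinite _)

theorem exists_isEdgeMatching (G : SimpleGraph V) :
    ∃ S : Finset (Sym2 V), ↑S ⊆ G.edgeSet ∧ IsEdgeMatching S ∧ S.card = G.matchingNumber := by
  obtain ⟨M, hM, hc⟩ := Nat.sSup_mem (s := {k : ℕ | ∃ M : G.Subgraph, M.IsMatching ∧
    M.edgeSet.ncard = k}) ⟨0, ⊥, by simp [Subgraph.IsMatching], by simp⟩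
    (matchingNumber_bddAbove G)
  have hfin : M.edgeSet.Finite := Set.toFinite _
  refine ⟨hfin.toFinset, ?_, ?_, ?_⟩
  · simpa using M.edgeSet_subset
  · intro e he f hf v hve hvf
    rw [Set.Finite.mem_toFinset] at he hf
    obtain ⟨a, rfl⟩ := Sym2.mem_iff_exists.1 hve
    obtain ⟨b, rfl⟩ := Sym2.mem_iff_exists.1 hvf
    rw [hM.eq_of_adj_left (Subgraph.mem_edgeSet.1 he) (Subgraph.mem_edgeSet.1 hf)]
  · rw [← Set.ncard_eq_toFinset_card _ hfin]
    exact hc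

theorem IsEdgeMatching.card_le_matchingNumber {G : SimpleGraph V} {S : Finset (Sym2 V)}
    (hS : IsEdgeMatching S) (hSG : ↑S ⊆ G.edgeSet) : S.card ≤ G.matchingNumber := by
  let M : G.Subgraph :=
    { verts := {v | ∃ e ∈ S, v ∈ e}
      Adj := fun a b => s(a, b) ∈ S
      adj_sub := fun h => hSG h
      edge_vert := fun {v w} h => ⟨s(v, w), h, Sym2.mem_mk_left v w⟩
      symm := ⟨fun a b h => by rwa [Sym2.eq_swap]⟩ }
  have hE : M.edgeSet = ↑S := by
    ext e
    induction e with | h a b => exact Iff.rfl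
  refine le_csSup (matchingNumber_bddAbove G) ⟨M, ?_, ?_⟩
  · rintro v ⟨e, he, hv⟩
    obtain ⟨a, rfl⟩ := Sym2.mem_iff_exists.1 hv
    refine ⟨a, he, fun b hb => ?_⟩
    have := hS _ hb _ he v (by simp) (by simp)
    exact Sym2.congr_right.1 this
  · rw [hE, Set.ncard_coe_finset]

theorem matchingNumber_mono {H G : SimpleGraph V} (h : H ≤ G) :
    H.matchingNumber ≤ G.matchingNumber := by
  obtain ⟨S, hSG, hS, hc⟩ := exists_isEdgeMatching H
  exact hc ▸ hS.card_le_matchingNumber (hSG.trans (edgeSet_mono h))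

@[simp]
theorem matchingNumber_bot : (⊥ : SimpleGraph V).matchingNumber = 0 := by
  obtain ⟨S, hSG, hS, hc⟩ := exists_isEdgeMatching (⊥ : SimpleGraph V)
  rw [← hc, Finset.card_eq_zero]
  simpa using hSG

theorem matchingNumber_sup_le (H₁ H₂ : SimpleGraph V) :
    (H₁ ⊔ H₂).matchingNumber ≤ H₁.matchingNumber + H₂.matchingNumber := by
  classical
  obtain ⟨S, hSG, hS, hc⟩ := exists_isEdgeMatching (H₁ ⊔ H₂)
  rw [← hc, ← Finset.card_filter_add_card_filter_not (s := S) (fun e => e ∈ H₁.edgeSet)]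
  refine add_le_add ((hS.subset (Finset.filter_subset _ _)).card_le_matchingNumber ?_)
    ((hS.subset (Finset.filter_subset _ _)).card_le_matchingNumber ?_)
  · intro e he
    exact (Finset.mem_filter.1 he).2
  · intro e he
    obtain ⟨h1, h2⟩ := Finset.mem_filter.1 he
    have := hSG h1
    rw [edgeSet_sup] at this
    exact this.resolve_left h2

theorem matchingNumber_add_le {H₁ H₂ G : SimpleGraph V} (h₁ : H₁ ≤ G) (h₂ : H₂ ≤ G)
    (h : ∀ v a b, H₁.Adj v a → ¬ H₂.Adj v b) :
    H₁.matchingNumber + H₂.matchingNumber ≤ G.matchingNumber := by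
  classical
  obtain ⟨S, hSG, hS, hc⟩ := exists_isEdgeMatching H₁
  obtain ⟨T, hTG, hT, hd⟩ := exists_isEdgeMatching H₂
  have key : ∀ e ∈ S, ∀ f ∈ T, ∀ v, v ∈ e → v ∈ f → False := by
    intro e he f hf v hve hvf
    obtain ⟨a, rfl⟩ := Sym2.mem_iff_exists.1 hve
    obtain ⟨b, rfl⟩ := Sym2.mem_iff_exists.1 hvf
    exact h v a b (hSG he) (hTG hf)
  have hdis : Disjoint S T := by
    rw [Finset.disjoint_left]
    intro e he hf
    induction e with | h a b => exact key _ he _ hf a (by simp) (by simp)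
  rw [← hc, ← hd, ← Finset.card_union_of_disjoint hdis]
  apply IsEdgeMatching.card_le_matchingNumber
  · intro e he f hf v hve hvf
    rcases Finset.mem_union.1 he with he | he <;> rcases Finset.mem_union.1 hf with hf | hf
    · exact hS e he f hf v hve hvf
    · exact (key e he f hf v hve hvf).elim
    · exact (key f hf e he v hvf hve).elim
    · exact hT e he f hf v hve hvf
  · rw [Finset.coe_union]
    exact Set.union_subset (hSG.trans (edgeSet_mono h₁)) (hTG.trans (edgeSet_mono h₂))

/-- Each vertex of `K` lies on at most one edge of a matching, so at most `K.card` of its edges fall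
outside `H`. -/
theorem matchingNumber_le_add_card {H G : SimpleGraph V} (K : Finset V)
    (h : ∀ a b, G.Adj a b → H.Adj a b ∨ a ∈ K ∨ b ∈ K) :
    G.matchingNumber ≤ H.matchingNumber + K.card := by
  classical
  obtain ⟨S, hSG, hS, hc⟩ := exists_isEdgeMatching G
  rw [← hc, ← Finset.card_filter_add_card_filter_not (s := S) (fun e => e ∈ H.edgeSet)]
  refine add_le_add ((hS.subset (Finset.filter_subset _ _)).card_le_matchingNumber ?_) ?_
  · intro e he
    exact (Finset.mem_filter.1 he).2
  · have hex : ∀ e ∈ S.filter (fun e => e ∉ H.edgeSet), ∃ v ∈ K, v ∈ e := by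
      intro e he
      obtain ⟨h1, h2⟩ := Finset.mem_filter.1 he
      induction e with
      | h a b =>
        rcases h a b (hSG h1) with h3 | h3 | h3
        · exact (h2 h3).elim
        · exact ⟨a, h3, by simp⟩
        · exact ⟨b, h3, by simp⟩
    refine Finset.card_le_card_of_forall_subsingleton (fun e v => v ∈ e) hex ?_
    rintro v - e ⟨he, hve⟩ f ⟨hf, hvf⟩
    exact hS e (Finset.mem_filter.1 he).1 f (Finset.mem_filter.1 hf).1 v hve hvf

theorem matchingNumber_add_one_le {H G : SimpleGraph V} (hle : H ≤ G) {u v : V} (huv : G.Adj u v)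
    (hu : ∀ a, ¬ H.Adj u a) (hv : ∀ a, ¬ H.Adj v a) :
    H.matchingNumber + 1 ≤ G.matchingNumber := by
  classical
  obtain ⟨S, hSG, hS, hc⟩ := exists_isEdgeMatching H
  have key : ∀ e ∈ S, ∀ w, w ∈ e → w ∉ s(u, v) := by
    intro e he w hw hw'
    obtain ⟨a, rfl⟩ := Sym2.mem_iff_exists.1 hw
    rcases Sym2.mem_iff.1 hw' with rfl | rfl
    · exact hu a (hSG he)
    · exact hv a (hSG he)
  have hnot : s(u, v) ∉ S := fun h' => key _ h' u (by simp) (by simp)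
  rw [← hc, ← Finset.card_insert_of_notMem hnot]
  apply IsEdgeMatching.card_le_matchingNumber
  · intro e he f hf w hwe hwf
    rcases Finset.mem_insert.1 he with rfl | he <;> rcases Finset.mem_insert.1 hf with rfl | hf
    · rfl
    · exact (key f hf w hwf hwe).elim
    · exact (key e he w hwe hwf).elim
    · exact hS e he f hf w hwe hwf
  · rw [Finset.coe_insert]
    exact Set.insert_subset huv (hSG.trans (edgeSet_mono hle))

/-- Choose a lift of each matching edge. Lifts that share `v` have images that share `f v`, so they
come from the same edge; `f` may identify vertices. -/
theorem matchingNumber_map_le [Finite W] (f : V → W) (H : SimpleGraph V) :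
    (H.map f).matchingNumber ≤ H.matchingNumber := by
  classical
  obtain ⟨S, hSG, hS, hc⟩ := exists_isEdgeMatching (H.map f)
  have hex : ∀ e ∈ S, ∃ e' ∈ H.edgeSet, e'.map f = e := by
    intro e he
    have := hSG he
    induction e with
    | h a b =>
      obtain ⟨hne, a', b', hab, rfl, rfl⟩ := this
      exact ⟨s(a', b'), hab, rfl⟩
  rcases S.eq_empty_or_nonempty with rfl | ⟨e₀, he₀⟩
  · simp [← hc]
  have : Nonempty (Sym2 V) := ⟨(hex e₀ he₀).choose⟩
  choose! g hgH hg using hex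
  have hinj : Set.InjOn g (S : Set (Sym2 W)) := by
    intro e he e' he' hee
    rw [← hg e he, ← hg e' he', hee]
  rw [← hc, ← Finset.card_image_of_injOn hinj]
  apply IsEdgeMatching.card_le_matchingNumber
  · intro e he e' he' v hv hv'
    obtain ⟨a, ha, rfl⟩ := Finset.mem_image.1 he
    obtain ⟨b, hb, rfl⟩ := Finset.mem_image.1 he'
    rw [hS a ha b hb (f v) (hg a ha ▸ Sym2.mem_map.2 ⟨v, hv, rfl⟩)
      (hg b hb ▸ Sym2.mem_map.2 ⟨v, hv', rfl⟩)]
  · intro e he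
    obtain ⟨a, ha, rfl⟩ := Finset.mem_image.1 (Finset.mem_coe.1 he)
    exact hgH a ha

theorem matchingNumber_le_map [Finite W] {f : V → W} (hf : Function.Injective f)
    (H : SimpleGraph V) : H.matchingNumber ≤ (H.map f).matchingNumber := by
  classical
  obtain ⟨S, hSG, hS, hc⟩ := exists_isEdgeMatching H
  rw [← hc, ← Finset.card_image_of_injective S (Sym2.map.injective hf)]
  apply IsEdgeMatching.card_le_matchingNumber
  · intro e he e' he' v hv hv'
    obtain ⟨a, ha, rfl⟩ := Finset.mem_image.1 he
    obtain ⟨b, hb, rfl⟩ := Finset.mem_image.1 he'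
    obtain ⟨x, hx, rfl⟩ := Sym2.mem_map.1 hv
    obtain ⟨y, hy, hxy⟩ := Sym2.mem_map.1 hv'
    obtain rfl := hf hxy
    rw [hS a ha b hb y hx hy]
  · intro e he
    obtain ⟨a, ha, rfl⟩ := Finset.mem_image.1 (Finset.mem_coe.1 he)
    have := hSG ha
    induction a with
    | h x y => exact ⟨fun h => this.ne (hf h), x, y, this, rfl, rfl⟩

end

theorem IsEdgeMatching.two_mul_card [Fintype V] [DecidableEq V] {G : SimpleGraph V}
    {S : Finset (Sym2 V)} (hS : IsEdgeMatching S) (hSG : ↑S ⊆ G.edgeSet) :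
    (S.biUnion Sym2.toFinset).card = 2 * S.card := by
  rw [Finset.card_biUnion, Finset.sum_congr rfl fun e he =>
    Sym2.card_toFinset_of_not_isDiag e (G.not_isDiag_of_mem_edgeSet (hSG he))]
  · simp [mul_comm]
  · intro e he f hf hef
    rw [Function.onFun, Finset.disjoint_left]
    intro v hv hv'
    exact hef (hS e he f hf v (Sym2.mem_toFinset.1 hv) (Sym2.mem_toFinset.1 hv'))

/-- The graph obtained by removing every edge with an endpoint in `K`. -/
def isolate (H : SimpleGraph V) (K : Set V) : SimpleGraph V where
  Adj a b := H.Adj a b ∧ a ∉ K ∧ b ∉ K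
  symm := ⟨fun _ _ h => ⟨h.1.symm, h.2.2, h.2.1⟩⟩
  loopless := ⟨fun _ h => h.1.ne rfl⟩

@[simp]
theorem isolate_adj {H : SimpleGraph V} {K : Set V} {a b : V} :
    (H.isolate K).Adj a b ↔ H.Adj a b ∧ a ∉ K ∧ b ∉ K := Iff.rfl

theorem isolate_le (H : SimpleGraph V) (K : Set V) : H.isolate K ≤ H := fun _ _ h => h.1

@[simp]
theorem isolate_empty (H : SimpleGraph V) : H.isolate ∅ = H := by
  ext; simp

theorem isolate_insert (H : SimpleGraph V) (K : Set V) (x : V) :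
    H.isolate (insert x K) = (H.isolate K).isolate {x} := by
  ext; simp; tauto

end SimpleGraph

/-! ### Bridges and the cyclomatic number -/

namespace SimpleGraph

variable {V : Type*}

theorem reachable_deleteEdges_iff_mem_cycle {H : SimpleGraph V} {a b : V} (hab : H.Adj a b) :
    (H.deleteEdges {s(a, b)}).Reachable a b ↔
      ∃ (u : V) (C : H.Walk u u), C.IsCycle ∧ s(a, b) ∈ C.edges := by
  rw [← adj_and_reachable_delete_edges_iff_exists_cycle]
  exact ⟨fun h => ⟨hab, h⟩, fun h => h.2⟩

theorem Walk.IsCycle.exists_le {H H' : SimpleGraph V} {u : V} {C : H.Walk u u} (hC : C.IsCycle)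
    (h : ∀ e ∈ C.edges, e ∈ H'.edgeSet) :
    ∃ D : H'.Walk u u, D.IsCycle ∧ D.edges = C.edges ∧ D.support = C.support :=
  ⟨C.transfer H' h, hC.transfer h, C.edges_transfer h, C.support_transfer h⟩

/-- An edge of a subgraph that lies on no cycle of the larger graph lies on no cycle of the
subgraph. -/
theorem not_reachable_deleteEdges_of_le {H G : SimpleGraph V} (hle : H ≤ G) {a b : V}
    (h : ¬ (G.deleteEdges {s(a, b)}).Reachable a b) :
    ¬ (H.deleteEdges {s(a, b)}).Reachable a b :=
  fun h' => h (h'.mono (deleteEdges_mono hle))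

theorem le_deleteEdges_singleton {H G : SimpleGraph V} (hle : H ≤ G) {a b : V}
    (h : ¬ H.Adj a b) : H ≤ G.deleteEdges {s(a, b)} := by
  intro x y hxy
  rw [deleteEdges_adj]
  refine ⟨hle hxy, fun hs => ?_⟩
  rcases Sym2.eq_iff.1 hs with ⟨rfl, rfl⟩ | ⟨rfl, rfl⟩
  · exact h hxy
  · exact h hxy.symm

theorem card_connectedComponent_deleteEdges_of_reachable {H : SimpleGraph V} {a b : V}
    (h : (H.deleteEdges {s(a, b)}).Reachable a b) :
    Nat.card (H.deleteEdges {s(a, b)}).ConnectedComponent = Nat.card H.ConnectedComponent := by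
  refine Nat.card_eq_of_bijective
    (ConnectedComponent.map (Hom.ofLE (deleteEdges_le {s(a, b)}))) ⟨?_, ?_⟩
  · have key : ∀ u v, H.Reachable u v → (H.deleteEdges {s(a, b)}).Reachable u v := by
      rintro u v ⟨p⟩
      induction p with
      | nil => exact Reachable.refl _
      | @cons x y z hxy p ih =>
        refine Reachable.trans ?_ ih
        by_cases hs : s(x, y) = s(a, b)
        · rcases Sym2.eq_iff.1 hs with ⟨rfl, rfl⟩ | ⟨rfl, rfl⟩
          · exact h
          · exact h.symm
        · exact Adj.reachable (by simp [hxy, hs])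
    intro c d
    induction c using ConnectedComponent.ind with | h u =>
    induction d using ConnectedComponent.ind with | h v =>
    intro huv
    exact ConnectedComponent.sound (key u v (ConnectedComponent.exact huv))
  · exact ConnectedComponent.surjective_map_ofLE _

@[simp]
theorem cyclomaticNumber_bot : (⊥ : SimpleGraph V).cyclomaticNumber = 0 := by
  have : Nat.card (⊥ : SimpleGraph V).ConnectedComponent = Nat.card V := by
    refine (Nat.card_eq_of_bijective (fun v => (⊥ : SimpleGraph V).connectedComponentMk v)
      ⟨?_, ?_⟩).symm
    · intro u v huv
      simpa using ConnectedComponent.exact huv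
    · intro c
      induction c using ConnectedComponent.ind with | h u => exact ⟨u, rfl⟩
  rw [cyclomaticNumber, this]
  simp

section

variable [Finite V]

theorem card_edgeSet_deleteEdges {H : SimpleGraph V} {a b : V} (hab : H.Adj a b) :
    Nat.card H.edgeSet = Nat.card (H.deleteEdges {s(a, b)}).edgeSet + 1 := by
  rw [Nat.card_coe_set_eq, Nat.card_coe_set_eq, edgeSet_deleteEdges,
    Set.ncard_sdiff_singleton_add_one (by exact hab) (Set.toFinite _)]

theorem card_connectedComponent_deleteEdges_of_not_reachable {H : SimpleGraph V} {a b : V}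
    (hab : H.Adj a b) (h : ¬ (H.deleteEdges {s(a, b)}).Reachable a b) :
    Nat.card (H.deleteEdges {s(a, b)}).ConnectedComponent =
      Nat.card H.ConnectedComponent + 1 := by
  classical
  set D := H.deleteEdges {s(a, b)} with hD
  -- A walk in `H` can be replaced by one that crosses the bridge at most once, in either direction.
  have key : ∀ u v, H.Reachable u v → D.Reachable u v ∨ (D.Reachable u a ∧ D.Reachable b v) ∨
      (D.Reachable u b ∧ D.Reachable a v) := by
    rintro u v ⟨p⟩
    induction p with
    | nil => exact Or.inl (Reachable.refl _)
    | @cons x y z hxy p ih =>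
      by_cases hs : s(x, y) = s(a, b)
      · rcases Sym2.eq_iff.1 hs with ⟨rfl, rfl⟩ | ⟨rfl, rfl⟩
        · rcases ih with h1 | ⟨h1, h2⟩ | ⟨h1, h2⟩
          · exact Or.inr (Or.inl ⟨Reachable.refl _, h1⟩)
          · exact (h h1.symm).elim
          · exact Or.inl h2
        · rcases ih with h1 | ⟨h1, h2⟩ | ⟨h1, h2⟩
          · exact Or.inr (Or.inr ⟨Reachable.refl _, h1⟩)
          · exact Or.inl h2
          · exact (h h1).elim
      · have h3 : D.Reachable x y := Adj.reachable (by simp [hD, hxy, hs])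
        rcases ih with h1 | ⟨h1, h2⟩ | ⟨h1, h2⟩
        · exact Or.inl (h3.trans h1)
        · exact Or.inr (Or.inl ⟨h3.trans h1, h2⟩)
        · exact Or.inr (Or.inr ⟨h3.trans h1, h2⟩)
  -- Restoring the edge merges the component of `b` with that of `a` and changes nothing else.
  have hbij : Function.Bijective (fun c : {c : D.ConnectedComponent // c ≠ D.connectedComponentMk b}
      => ConnectedComponent.map (Hom.ofLE (deleteEdges_le {s(a, b)} : D ≤ H)) c.1) := by
    constructor
    · rintro ⟨c, hc⟩ ⟨d, hd⟩
      induction c using ConnectedComponent.ind with | h u =>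
      induction d using ConnectedComponent.ind with | h v =>
      intro huv
      have h1 : H.Reachable u v := ConnectedComponent.exact huv
      rw [Subtype.mk.injEq]
      rcases key u v h1 with h1 | ⟨h1, h2⟩ | ⟨h1, h2⟩
      · exact ConnectedComponent.sound h1
      · exact (hd (ConnectedComponent.sound h2.symm)).elim
      · exact (hc (ConnectedComponent.sound h1)).elim
    · intro c
      induction c using ConnectedComponent.ind with | h u =>
      by_cases hu : D.Reachable u b
      · refine ⟨⟨D.connectedComponentMk a, fun h' => h (ConnectedComponent.exact h')⟩, ?_⟩
        exact ConnectedComponent.sound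
          (hab.reachable.trans (hu.mono (deleteEdges_le _)).symm)
      · exact ⟨⟨D.connectedComponentMk u, fun h' => hu (ConnectedComponent.exact h')⟩, rfl⟩
  rw [← Nat.card_eq_of_bijective _ hbij]
  have := Set.ncard_sdiff_singleton_add_one (Set.mem_univ (D.connectedComponentMk b))
    (Set.toFinite _)
  rw [Set.ncard_univ] at this
  rw [← this, ← Nat.card_coe_set_eq]
  congr 1
  exact Nat.card_congr (Equiv.subtypeEquivRight fun c => by simp)

theorem cyclomaticNumber_deleteEdges_of_reachable {H : SimpleGraph V} {a b : V} (hab : H.Adj a b)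
    (h : (H.deleteEdges {s(a, b)}).Reachable a b) :
    (H.deleteEdges {s(a, b)}).cyclomaticNumber = H.cyclomaticNumber - 1 := by
  rw [cyclomaticNumber, cyclomaticNumber, card_edgeSet_deleteEdges hab,
    card_connectedComponent_deleteEdges_of_reachable h]
  push_cast
  ring

theorem cyclomaticNumber_deleteEdges_of_not_reachable {H : SimpleGraph V} {a b : V}
    (hab : H.Adj a b) (h : ¬ (H.deleteEdges {s(a, b)}).Reachable a b) :
    (H.deleteEdges {s(a, b)}).cyclomaticNumber = H.cyclomaticNumber := by
  rw [cyclomaticNumber, cyclomaticNumber, card_edgeSet_deleteEdges hab,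
    card_connectedComponent_deleteEdges_of_not_reachable hab h]
  push_cast
  ring

/-- Induction on subgraphs: pass from a graph to a subgraph by deleting edges one by one. -/
theorem deleteEdges_induction {H : SimpleGraph V} {P : SimpleGraph V → Prop} (h0 : P H)
    (step : ∀ (G : SimpleGraph V) (a b : V), H ≤ G → G.Adj a b → ¬ H.Adj a b →
      P (G.deleteEdges {s(a, b)}) → P G) (G : SimpleGraph V) (hle : H ≤ G) : P G := by
  induction hn : Nat.card G.edgeSet using Nat.strong_induction_on generalizing G with
  | _ n ih =>
    by_cases hG : G ≤ H
    · exact le_antisymm hG hle ▸ h0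
    · obtain ⟨a, b, hab, hnab⟩ : ∃ a b, G.Adj a b ∧ ¬ H.Adj a b := by
        by_contra! hcon
        exact hG fun a b hab => hcon a b hab
      refine step G a b hle hab hnab (ih _ ?_ _ ?_ rfl)
      · rw [← hn, card_edgeSet_deleteEdges hab]
        exact Nat.lt_succ_self _
      · exact le_deleteEdges_singleton hle hnab

theorem cyclomaticNumber_mono {H G : SimpleGraph V} (hle : H ≤ G) :
    H.cyclomaticNumber ≤ G.cyclomaticNumber := by
  refine deleteEdges_induction (P := fun G => H.cyclomaticNumber ≤ G.cyclomaticNumber) le_rfl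
    ?_ G hle
  intro G a b _ hab _ ih
  by_cases h : (G.deleteEdges {s(a, b)}).Reachable a b
  · rw [cyclomaticNumber_deleteEdges_of_reachable hab h] at ih
    omega
  · rwa [cyclomaticNumber_deleteEdges_of_not_reachable hab h] at ih

/-- Deleting edges that lie on no cycle does not change the cyclomatic number. -/
theorem cyclomaticNumber_eq_of_not_reachable {H G : SimpleGraph V} (hle : H ≤ G)
    (h : ∀ a b, G.Adj a b → ¬ H.Adj a b → ¬ (G.deleteEdges {s(a, b)}).Reachable a b) :
    H.cyclomaticNumber = G.cyclomaticNumber := by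
  refine deleteEdges_induction (P := fun G' => G' ≤ G → H.cyclomaticNumber = G'.cyclomaticNumber)
    (fun _ => rfl) ?_ G hle le_rfl
  intro G' a b _ hab hnab ih hG'
  rw [ih ((deleteEdges_le _).trans hG')]
  exact cyclomaticNumber_deleteEdges_of_not_reachable hab
    (not_reachable_deleteEdges_of_le hG' (h a b (hG' hab) hnab))

theorem IsAcyclic.cyclomaticNumber_eq_zero {H : SimpleGraph V} (hH : H.IsAcyclic) :
    H.cyclomaticNumber = 0 := by
  rw [← cyclomaticNumber_bot (V := V)]
  refine (cyclomaticNumber_eq_of_not_reachable bot_le fun a b hab _ h => ?_).symm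
  obtain ⟨u, C, hC, -⟩ := (reachable_deleteEdges_iff_mem_cycle hab).1 h
  exact hH C hC

theorem cyclomaticNumber_lt_of_cycle {H H' : SimpleGraph V} (hle : H' ≤ H) {a b : V}
    (hab : H.Adj a b) (hnab : ¬ H'.Adj a b)
    (h : (H.deleteEdges {s(a, b)}).Reachable a b) :
    H'.cyclomaticNumber + 1 ≤ H.cyclomaticNumber := by
  have := cyclomaticNumber_mono (le_deleteEdges_singleton hle hnab)
  rw [cyclomaticNumber_deleteEdges_of_reachable hab h] at this
  omega

end

end SimpleGraph

/-! ### Forests and vertex covers -/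

namespace SimpleGraph

variable {V : Type*}

/-- The first vertex of a longest path is a leaf: a neighbour off the path would extend it, and one
on the path beyond the second vertex would close a cycle. -/
theorem IsAcyclic.exists_leaf [Finite V] {H : SimpleGraph V} (hH : H.IsAcyclic) (hne : H ≠ ⊥) :
    ∃ u v, H.Adj u v ∧ ∀ w, H.Adj u w → w = v := by
  classical
  obtain ⟨a, b, hab⟩ : ∃ a b, H.Adj a b := by
    by_contra! hcon
    exact hne (by ext a b; simp [hcon a b])
  have : Nonempty V := ⟨a⟩
  obtain ⟨u, z, p, hp, hmax⟩ := Walk.exists_isPath_forall_isPath_length_le_length H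
  have hlen : 1 ≤ p.length := by simpa using hmax a b hab.toWalk hab.isPath_toWalk
  have hnil : ¬ p.Nil := by
    rw [Walk.not_nil_iff_lt_length]; exact hlen
  refine ⟨u, p.snd, p.adj_snd hnil, fun w huw => ?_⟩
  by_cases hw : w ∈ p.support
  · exact hH.eq_snd_of_adj_start hp huw hw
  · have := hmax w z (Walk.cons huw.symm p) (hp.cons hw)
    simp at this

theorem card_edgeSet_isolate_lt [Finite V] {H : SimpleGraph V} {K : Set V} {x y : V} (hx : x ∈ K)
    (hxy : H.Adj x y) : Nat.card (H.isolate K).edgeSet < Nat.card H.edgeSet := by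
  rw [Nat.card_coe_set_eq, Nat.card_coe_set_eq]
  apply Set.ncard_lt_ncard _ (Set.toFinite _)
  refine ⟨edgeSet_mono (isolate_le H K), fun h => ?_⟩
  exact (h (show s(x, y) ∈ H.edgeSet from hxy)).2.1 hx

/-- Induction on forests: pick a leaf `u` with neighbour `v` and remove all edges at `v`. -/
theorem IsAcyclic.leaf_induction [Finite V] {P : SimpleGraph V → Prop} (hbot : P ⊥)
    (step : ∀ (H : SimpleGraph V) (u v : V), H.Adj u v → (∀ w, H.Adj u w → w = v) →
      P (H.isolate {v}) → P H) {H : SimpleGraph V} (hH : H.IsAcyclic) : P H := by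
  induction hn : Nat.card H.edgeSet using Nat.strong_induction_on generalizing H with
  | _ n ih =>
    by_cases hb : H = ⊥
    · exact hb ▸ hbot
    · obtain ⟨u, v, huv, hu⟩ := hH.exists_leaf hb
      refine step H u v huv hu (ih _ ?_ (hH.anti (isolate_le H _)) rfl)
      exact hn ▸ card_edgeSet_isolate_lt (Set.mem_singleton v) huv.symm

theorem matchingNumber_isolate_add_one_le [Finite V] {H : SimpleGraph V} {u v : V}
    (huv : H.Adj u v) (hu : ∀ w, H.Adj u w → w = v) :
    (H.isolate {v}).matchingNumber + 1 ≤ H.matchingNumber :=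
  matchingNumber_add_one_le (isolate_le H _) huv
    (fun a h => h.2.2 (hu a h.1)) fun _ h => h.2.1 rfl

theorem matchingNumber_le_isolate_add_card [Finite V] (H : SimpleGraph V) (K : Finset V) :
    H.matchingNumber ≤ (H.isolate K).matchingNumber + K.card :=
  matchingNumber_le_add_card K fun a b hab => by
    simp only [isolate_adj, Finset.mem_coe]; tauto

/-- König's theorem for forests. -/
theorem IsAcyclic.exists_cover [Finite V] {H : SimpleGraph V} (hH : H.IsAcyclic) :
    ∃ K : Finset V, K.card ≤ H.matchingNumber ∧ ∀ a b, H.Adj a b → a ∈ K ∨ b ∈ K := by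
  classical
  refine hH.leaf_induction (P := fun H => ∃ K : Finset V, K.card ≤ H.matchingNumber ∧
    ∀ a b, H.Adj a b → a ∈ K ∨ b ∈ K) ⟨∅, by simp, by simp⟩ ?_
  rintro H u v huv hu ⟨K, hK, hcov⟩
  -- The edge from the leaf `u` to `v` extends any matching that avoids `v`, so adding `v` to the
  -- cover is paid for by one more matching edge.
  refine ⟨insert v K, ?_, ?_⟩
  · have := matchingNumber_isolate_add_one_le huv hu
    have := Finset.card_insert_le v K
    omega
  · intro a b hab
    simp only [Finset.mem_insert]
    have := hcov a b
    simp only [isolate_adj, Set.mem_singleton_iff] at this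
    tauto

theorem cyclomaticNumber_isolate_lt [Finite V] {H : SimpleGraph V} {x u : V} {C : H.Walk u u}
    (hC : C.IsCycle) (hx : x ∈ C.support) :
    (H.isolate {x}).cyclomaticNumber + 1 ≤ H.cyclomaticNumber := by
  classical
  have hC' := (Walk.isCycle_rotate hx).2 hC
  have hnil := hC'.not_nil
  have hadj := (C.rotate x hx).adj_snd hnil
  refine cyclomaticNumber_lt_of_cycle (isolate_le H _) hadj (fun h => h.2.1 rfl) ?_
  rw [reachable_deleteEdges_iff_mem_cycle hadj]
  exact ⟨_, _, hC', Walk.mk_start_snd_mem_edges hnil⟩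

/-- Every graph has a vertex cover of size at most the sum of its matching number and its
cyclomatic number. -/
theorem exists_cover_card_le [Finite V] (H : SimpleGraph V) :
    ∃ K : Finset V, (K.card : ℤ) ≤ H.matchingNumber + H.cyclomaticNumber ∧
      ∀ a b, H.Adj a b → a ∈ K ∨ b ∈ K := by
  classical
  induction hn : Nat.card H.edgeSet using Nat.strong_induction_on generalizing H with
  | _ n ih =>
    by_cases hH : H.IsAcyclic
    · obtain ⟨K, hK, hcov⟩ := hH.exists_cover
      refine ⟨K, ?_, hcov⟩
      rw [hH.cyclomaticNumber_eq_zero]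
      omega
    · simp only [IsAcyclic, not_forall, not_not] at hH
      obtain ⟨x, C, hC⟩ := hH
      have hx := C.start_mem_support
      obtain ⟨K, hK, hcov⟩ := ih _ (hn ▸ card_edgeSet_isolate_lt (Set.mem_singleton x)
        (C.adj_snd hC.not_nil)) (H.isolate {x}) rfl
      refine ⟨insert x K, ?_, ?_⟩
      -- The cyclomatic number, not the matching number, pays for the cycle vertex `x`.
      · have h1 := cyclomaticNumber_isolate_lt hC hx
        have h2 := matchingNumber_mono (isolate_le H {x})
        have h3 := Finset.card_insert_le x K
        omega
      · intro a b hab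
        simp only [Finset.mem_insert]
        have := hcov a b
        simp only [isolate_adj, Set.mem_singleton_iff] at this
        tauto

/-! ### Hermitian forms supported on subgraphs -/

open Classical in
/-- The matrix obtained from `A` by erasing the entries at pairs which are not adjacent. -/
noncomputable def maskMatrix (A : Matrix V V ℂ) (H : SimpleGraph V) : Matrix V V ℂ :=
  Matrix.of fun u v => if H.Adj u v then A u v else 0

theorem maskMatrix_re_symm {A : Matrix V V ℂ} (hA : A.IsHermitian) (H : SimpleGraph V) (w : V → ℂ)
    (u v : V) : (star (w u) * maskMatrix A H u v * w v).re =
      (star (w v) * maskMatrix A H v u * w u).re := by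
  have h1 : star (maskMatrix A H v u) = maskMatrix A H u v := by
    by_cases huv : H.Adj u v
    · simpa [maskMatrix, huv, huv.symm] using hA.apply u v
    · simp [maskMatrix, huv, H.adj_comm v u]
  rw [← h1, ← Complex.conj_re, ← starRingEnd_apply]
  simp only [RCLike.star_def, map_mul, Complex.conj_conj]
  congr 1
  ring

variable [Fintype V]

open Classical in
/-- The Hermitian form of the matrix obtained from `A` by erasing the entries at pairs which are
not adjacent in `H`. -/
noncomputable def energy (A : Matrix V V ℂ) (H : SimpleGraph V) (w : V → ℂ) : ℝ :=
  ∑ u, ∑ v, if H.Adj u v then (star (w u) * A u v * w v).re else 0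

theorem energy_congr {A : Matrix V V ℂ} {H : SimpleGraph V} {w z : V → ℂ}
    (h : ∀ a b, H.Adj a b → w a = z a) : energy A H w = energy A H z := by
  refine Finset.sum_congr rfl fun u _ => Finset.sum_congr rfl fun v _ => ?_
  split_ifs with huv
  · rw [h u v huv, h v u huv.symm]
  · rfl

theorem energy_eq_of_adj {A : Matrix V V ℂ} {H G : SimpleGraph V} {w : V → ℂ} (hle : H ≤ G)
    (h : ∀ a b, G.Adj a b → H.Adj a b ∨ w a = 0 ∨ w b = 0) : energy A G w = energy A H w := by
  refine Finset.sum_congr rfl fun u _ => Finset.sum_congr rfl fun v _ => ?_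
  by_cases h1 : H.Adj u v
  · rw [if_pos h1, if_pos (hle h1)]
  · rw [if_neg h1]
    split_ifs with h2
    · rcases h u v h2 with h3 | h3 | h3
      · exact (h1 h3).elim
      · simp [h3]
      · simp [h3]
    · rfl

theorem energy_sup {A : Matrix V V ℂ} {H₁ H₂ : SimpleGraph V} (w : V → ℂ)
    (h : ∀ a b, H₁.Adj a b → ¬ H₂.Adj a b) :
    energy A (H₁ ⊔ H₂) w = energy A H₁ w + energy A H₂ w := by
  simp only [energy, ← Finset.sum_add_distrib]
  refine Finset.sum_congr rfl fun u _ => Finset.sum_congr rfl fun v _ => ?_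
  have := h u v
  by_cases h1 : H₁.Adj u v <;> by_cases h2 : H₂.Adj u v <;> simp_all

@[simp]
theorem energy_zero (A : Matrix V V ℂ) (H : SimpleGraph V) : energy A H 0 = 0 := by
  simp [energy]

@[simp]
theorem energy_bot (A : Matrix V V ℂ) (w : V → ℂ) : energy A ⊥ w = 0 := by
  simp [energy]

theorem energy_neg (A : Matrix V V ℂ) (H : SimpleGraph V) (w : V → ℂ) :
    energy (-A) H w = - energy A H w := by
  simp only [energy, ← Finset.sum_neg_distrib]
  refine Finset.sum_congr rfl fun u _ => Finset.sum_congr rfl fun v _ => ?_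
  split_ifs <;> simp

theorem posIndex_energy_le_add_card {A : Matrix V V ℂ} {H G : SimpleGraph V} (hle : H ≤ G)
    (K : Finset V) (h : ∀ a b, G.Adj a b → H.Adj a b ∨ a ∈ K ∨ b ∈ K) :
    posIndex (energy A G) ≤ posIndex (energy A H) + K.card := by
  have := posIndex_le_add_card (Q := energy A G) (Q₁ := energy A H)
    (LinearMap.funLeft ℂ ℂ (Subtype.val : K → V)) LinearMap.id (by simp) (by
      intro w hw
      refine (energy_eq_of_adj hle fun a b hab => ?_).le
      have hK : ∀ a ∈ K, w a = 0 := fun a ha => congrFun hw ⟨a, ha⟩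
      rcases h a b hab with h1 | h1 | h1
      · exact Or.inl h1
      · exact Or.inr (Or.inl (hK a h1))
      · exact Or.inr (Or.inr (hK b h1)))
  simpa using this

theorem posIndex_energy_le_card {A : Matrix V V ℂ} {G : SimpleGraph V}
    (K : Finset V) (h : ∀ a b, G.Adj a b → a ∈ K ∨ b ∈ K) :
    posIndex (energy A G) ≤ K.card := by
  have := posIndex_energy_le_add_card (A := A) (bot_le : ⊥ ≤ G) K fun a b hab => Or.inr (h a b hab)
  rwa [posIndex_eq_zero (Q := energy A ⊥) (by simp), zero_add] at this

theorem posIndex_energy_le (A : Matrix V V ℂ) (H : SimpleGraph V) :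
    (posIndex (energy A H) : ℤ) ≤ H.matchingNumber + H.cyclomaticNumber := by
  obtain ⟨K, hK, hcov⟩ := exists_cover_card_le H
  have := posIndex_energy_le_card (A := A) K hcov
  omega

theorem posIndex_energy_add_le {A : Matrix V V ℂ} {H₁ H₂ : SimpleGraph V}
    (h : ∀ v a b, H₁.Adj v a → ¬ H₂.Adj v b) :
    posIndex (energy A H₁) + posIndex (energy A H₂) ≤ posIndex (energy A (H₁ ⊔ H₂)) := by
  classical
  let T : (V → ℂ) × (V → ℂ) →ₗ[ℂ] (V → ℂ) :=
    { toFun := fun p v => if ∃ a, H₁.Adj v a then p.1 v else p.2 v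
      map_add' := fun p q => by ext v; simp only [Pi.add_apply, Prod.fst_add, Prod.snd_add]
                                split_ifs <;> rfl
      map_smul' := fun c p => by ext v; simp only [Pi.smul_apply, Prod.smul_fst, Prod.smul_snd,
                                  RingHom.id_apply]; split_ifs <;> rfl }
  refine posIndex_add_le T (by simp) (by simp) (by simp) fun x y => ?_
  rw [energy_sup _ fun a b => h a b b]
  refine (congrArg₂ (· + ·) (energy_congr fun a b hab => ?_) (energy_congr fun a b hab => ?_)).le
  · exact (if_pos ⟨b, hab⟩).symm
  · exact (if_neg fun ⟨c, hc⟩ => h a c b hc hab).symm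

theorem energy_eq_sum_maskMatrix (A : Matrix V V ℂ) (H : SimpleGraph V) (w : V → ℂ) :
    energy A H w = ∑ u, ∑ v, (star (w u) * maskMatrix A H u v * w v).re := by
  refine Finset.sum_congr rfl fun u _ => Finset.sum_congr rfl fun v _ => ?_
  simp only [maskMatrix, Matrix.of_apply]
  split_ifs <;> simp

/-- By Hermitian symmetry the two mixed blocks have equal real parts, whence the factor 2; the block
off `K` is the form of `H`. The rest pairs each coordinate in `K` with a value of its row, which can
be prescribed freely when the rows are independent. -/
theorem energy_eq_add_rows [DecidableEq V] {A : Matrix V V ℂ} (hA : A.IsHermitian)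
    {H G : SimpleGraph V} (hle : H ≤ G) (K : Finset V)
    (h : ∀ a b, G.Adj a b → H.Adj a b ∨ a ∈ K ∨ b ∈ K) (hK : ∀ a b, H.Adj a b → a ∉ K)
    (w : V → ℂ) :
    energy A G w = energy A H w + ∑ u ∈ K, (star (w u) *
      (∑ v ∈ K, maskMatrix A G u v * w v + 2 * ∑ v ∈ Kᶜ, maskMatrix A G u v * w v)).re := by
  classical
  have hH : energy A H w = ∑ u ∈ Kᶜ, ∑ v ∈ Kᶜ, (star (w u) * maskMatrix A G u v * w v).re := by
    rw [energy_eq_sum_maskMatrix, ← Finset.sum_add_sum_compl K,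
      Finset.sum_eq_zero (s := K), zero_add]
    · refine Finset.sum_congr rfl fun u hu => ?_
      rw [← Finset.sum_add_sum_compl K, Finset.sum_eq_zero (s := K), zero_add]
      · refine Finset.sum_congr rfl fun v hv => ?_
        rw [Finset.mem_compl] at hu hv
        have : H.Adj u v ↔ G.Adj u v := ⟨fun h' => hle h', fun h' => by
          rcases h u v h' with h1 | h1 | h1
          · exact h1
          · exact (hu h1).elim
          · exact (hv h1).elim⟩
        simp only [maskMatrix, Matrix.of_apply, this]
      · intro v hv
        have : ¬ H.Adj u v := fun h' => hK v u h'.symm hv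
        simp [maskMatrix, this]
    · intro u hu
      refine Finset.sum_eq_zero fun v _ => ?_
      have : ¬ H.Adj u v := fun h' => hK u v h' hu
      simp [maskMatrix, this]
  rw [hH, energy_eq_sum_maskMatrix, ← Finset.sum_add_sum_compl K]
  have h1 : ∀ u, ∑ v, (star (w u) * maskMatrix A G u v * w v).re =
      ∑ v ∈ K, (star (w u) * maskMatrix A G u v * w v).re +
      ∑ v ∈ Kᶜ, (star (w u) * maskMatrix A G u v * w v).re := fun u =>
    (Finset.sum_add_sum_compl K _).symm
  simp only [h1, Finset.sum_add_distrib]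
  have h2 : ∑ u ∈ Kᶜ, ∑ v ∈ K, (star (w u) * maskMatrix A G u v * w v).re =
      ∑ u ∈ K, ∑ v ∈ Kᶜ, (star (w u) * maskMatrix A G u v * w v).re := by
    rw [Finset.sum_comm]
    exact Finset.sum_congr rfl fun u _ => Finset.sum_congr rfl fun v _ =>
      maskMatrix_re_symm hA G w v u
  have h3 : ∀ u, (star (w u) * (∑ v ∈ K, maskMatrix A G u v * w v +
      2 * ∑ v ∈ Kᶜ, maskMatrix A G u v * w v)).re =
      ∑ v ∈ K, (star (w u) * maskMatrix A G u v * w v).re +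
      2 * ∑ v ∈ Kᶜ, (star (w u) * maskMatrix A G u v * w v).re := by
    intro u
    rw [mul_add, mul_left_comm, Finset.mul_sum, Finset.mul_sum, Complex.add_re, Complex.re_sum,
      show (2 : ℂ) = ((2 : ℝ) : ℂ) by norm_num, Complex.re_ofReal_mul, Complex.re_sum]
    simp only [mul_assoc]
  rw [h2]
  simp only [h3, Finset.sum_add_distrib, ← Finset.mul_sum]
  ring

/-- Let every edge of `G` that is not an edge of `H` have an endpoint in `K`, and suppose that the
rows of `A` indexed by `K` are independent on a set `X` of columns at which `H` has no edges. Then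
`K` contributes `#K` hyperbolic planes to the form of `G`, besides the form of `H`. -/
theorem posIndex_energy_add_card_le {A : Matrix V V ℂ} (hA : A.IsHermitian) {H G : SimpleGraph V}
    (hle : H ≤ G) (K : Finset V) (X : Set V) (h : ∀ a b, G.Adj a b → H.Adj a b ∨ a ∈ K ∨ b ∈ K)
    (hK : ∀ a b, H.Adj a b → a ∉ K) (hX : ∀ a b, H.Adj a b → a ∉ X) (hKX : ∀ a ∈ K, a ∉ X)
    (hsurj : ∀ c : K → ℂ, ∃ w : V → ℂ, (∀ v, v ∉ X → w v = 0) ∧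
      ∀ u : K, ∑ v, maskMatrix A G u v * w v = c u) :
    posIndex (energy A H) + K.card ≤ posIndex (energy A G) := by
  classical
  -- the projection to the coordinates in a set
  let P : Set V → (V → ℂ) →ₗ[ℂ] (V → ℂ) := fun Y =>
    { toFun := fun w v => if v ∈ Y then w v else 0
      map_add' := fun p q => by ext v; simp only [Pi.add_apply]; split_ifs <;> simp
      map_smul' := fun c p => by ext v; simp }
  let rows : (V → ℂ) →ₗ[ℂ] (K → ℂ) :=
    LinearMap.funLeft ℂ ℂ (Subtype.val : K → V) ∘ₗ (maskMatrix A G).mulVecLin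
  have hrows : ∀ w (u : K), rows w u = ∑ v, maskMatrix A G u v * w v := fun w u => rfl
  let R : (V → ℂ) →ₗ[ℂ] (K → ℂ) := rows ∘ₗ P X
  have hRsurj : Function.Surjective R := by
    intro c
    obtain ⟨w, hw, hwc⟩ := hsurj c
    refine ⟨w, ?_⟩
    have : P X w = w := by
      ext v
      change (if v ∈ X then w v else 0) = w v
      split_ifs with hv
      · rfl
      · exact (hw v hv).symm
    ext u
    change rows (P X w) u = _
    rw [this, hrows, hwc]
  obtain ⟨S, hS⟩ := LinearMap.exists_rightInverse_of_surjective R (LinearMap.range_eq_top.2 hRsurj)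
  have hS' : ∀ c, rows (P X (S c)) = c := fun c => LinearMap.congr_fun hS c
  let ext0 : (K → ℂ) →ₗ[ℂ] (V → ℂ) :=
    Function.ExtendByZero.linearMap ℂ (Subtype.val : K → V)
  have hext : ∀ (k : K → ℂ) (u : K), ext0 k u = k u := fun k u =>
    Subtype.val_injective.extend_apply _ _ _
  have hext' : ∀ (k : K → ℂ) (v : V), v ∉ K → ext0 k v = 0 := fun k v hv =>
    Function.extend_apply' _ _ _ (by rintro ⟨a, rfl⟩; exact hv a.2)
  let b : (V → ℂ) × (K → ℂ) →ₗ[ℂ] (V → ℂ) :=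
    P ((K : Set V) ∪ X)ᶜ ∘ₗ LinearMap.fst ℂ _ _
  let e : (V → ℂ) × (K → ℂ) →ₗ[ℂ] (V → ℂ) := ext0 ∘ₗ LinearMap.snd ℂ _ _
  -- A correction supported on `X` is not seen by `H`. This value makes (own block) + 2 (rest of the
  -- row) equal to `k`, so that the pairing becomes the sum of the `‖k u‖ ^ 2`.
  let c : (V → ℂ) × (K → ℂ) →ₗ[ℂ] (K → ℂ) :=
    (1 / 2 : ℂ) • (LinearMap.snd ℂ _ _ - rows ∘ₗ e) - rows ∘ₗ b
  let T : (V → ℂ) × (K → ℂ) →ₗ[ℂ] (V → ℂ) := e + b + P X ∘ₗ S ∘ₗ c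
  have hcard : posIndex (fun k : K → ℂ => ∑ u, ‖k u‖ ^ 2) = K.card := by
    rw [posIndex_pos_def, Module.finrank_fintype_fun_eq_card, Fintype.card_coe]
    intro k hk
    obtain ⟨i, hi⟩ := Function.ne_iff.1 hk
    exact Finset.sum_pos' (fun j _ => by positivity)
      ⟨i, Finset.mem_univ i, pow_pos (norm_pos_iff.2 hi) 2⟩
  rw [← hcard]
  refine posIndex_add_le T (by simp) (by simp) (by simp) fun w k => ?_
  have heK : ∀ u : K, e (w, k) u = k u := hext k
  have hb : ∀ v, b (w, k) v = P ((K : Set V) ∪ X)ᶜ w v := fun v => rfl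
  have hP : ∀ Y z v, P Y z v = if v ∈ Y then z v else 0 := fun Y z v => rfl
  have hT : ∀ v, T (w, k) v = e (w, k) v + b (w, k) v + P X (S (c (w, k))) v := fun v => rfl
  have hTK : ∀ u : K, T (w, k) u = k u := by
    intro u
    rw [hT, heK, hb, hP, hP, if_neg (by simp), if_neg (hKX u u.2)]
    simp
  have hTH : ∀ v, v ∉ K → T (w, k) v = b (w, k) v + P X (S (c (w, k))) v := by
    intro v hv
    rw [hT, show e (w, k) v = 0 from hext' k v hv, zero_add]
  rw [energy_eq_add_rows hA hle K h hK]
  refine add_le_add (energy_congr fun a a' ha => ?_).le ?_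
  · have h1 := hK a a' ha
    have h2 := hX a a' ha
    rw [hTH a h1, hb, hP, hP, if_pos (by simp [h1, h2]), if_neg h2, add_zero]
  · rw [← Finset.sum_coe_sort K]
    refine Finset.sum_le_sum fun u _ => ?_
    have h1 : ∑ v ∈ K, maskMatrix A G u v * T (w, k) v = rows (e (w, k)) u := by
      rw [hrows, ← Finset.sum_add_sum_compl K, Finset.sum_eq_zero (s := Kᶜ), add_zero]
      · refine Finset.sum_congr rfl fun v hv => ?_
        rw [hTK ⟨v, hv⟩, heK ⟨v, hv⟩]
      · intro v hv
        rw [show e (w, k) v = 0 from hext' k v (Finset.mem_compl.1 hv), mul_zero]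
    have h2 : ∑ v ∈ Kᶜ, maskMatrix A G u v * T (w, k) v =
        rows (b (w, k)) u + rows (P X (S (c (w, k)))) u := by
      rw [hrows, hrows, ← Finset.sum_add_distrib, ← Finset.sum_add_sum_compl K,
        Finset.sum_eq_zero (s := K), zero_add]
      · refine Finset.sum_congr rfl fun v hv => ?_
        rw [hTH v (Finset.mem_compl.1 hv)]
        ring
      · intro v hv
        rw [hb, hP, hP, if_neg (by simp [hv]), if_neg (hKX v hv)]
        simp
    rw [h1, h2, hS', hTK]
    have h3 : c (w, k) u = 1 / 2 * (k u - rows (e (w, k)) u) - rows (b (w, k)) u := rfl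
    rw [h3, show rows (e (w, k)) u + 2 * (rows (b (w, k)) u + (1 / 2 * (k u - rows (e (w, k)) u) -
      rows (b (w, k)) u)) = k u by ring, RCLike.star_def, ← Complex.normSq_eq_conj_mul_self,
      Complex.ofReal_re, Complex.normSq_eq_norm_sq]

/-- A leaf `u` with neighbour `v` yields one hyperbolic plane, with `K = {v}` and `X = {u}`. Only
Hermitian symmetry and nonzero entries matter, so the bound also applies to `-A`. -/
theorem IsAcyclic.matchingNumber_le_posIndex {A : Matrix V V ℂ} (hA : A.IsHermitian)
    {H : SimpleGraph V} (hH : H.IsAcyclic) (hne : ∀ u v, H.Adj u v → A u v ≠ 0) :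
    H.matchingNumber ≤ posIndex (energy A H) := by
  classical
  refine hH.leaf_induction (P := fun H => (∀ u v, H.Adj u v → A u v ≠ 0) →
    H.matchingNumber ≤ posIndex (energy A H)) (by simp) ?_ hne
  intro H u v huv hu ih hne
  have h1 := ih fun a b hab => hne a b (isolate_le H _ hab)
  have h2 := matchingNumber_le_isolate_add_card H {v}
  rw [Finset.coe_singleton, Finset.card_singleton] at h2
  refine h2.trans ((Nat.add_le_add_right h1 1).trans ?_)
  rw [← Finset.card_singleton v]
  refine posIndex_energy_add_card_le hA (isolate_le H _) {v} {u} ?_ ?_ ?_ ?_ ?_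
  · intro a b hab
    simp only [isolate_adj, Set.mem_singleton_iff, Finset.mem_singleton]
    tauto
  · intro a b hab
    simpa using hab.2.1
  · rintro a b hab rfl
    exact hab.2.2 (hu b hab.1)
  · intro a ha
    rw [Finset.mem_singleton.1 ha]
    exact huv.ne'
  · intro c
    have hv : A v u ≠ 0 := hne v u huv.symm
    refine ⟨Pi.single u ((A v u)⁻¹ * c ⟨v, by simp⟩), fun x hx => Pi.single_eq_of_ne hx _, ?_⟩
    rintro ⟨x, hx⟩
    obtain rfl := Finset.mem_singleton.1 hx
    rw [Finset.sum_eq_single u]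
    · simp [maskMatrix, huv.symm, hv]
    · intro b _ hb
      simp [Pi.single_eq_of_ne hb]
    · simp

end SimpleGraph

/-! ### Graphs attaining the upper bound -/

namespace SimpleGraph

variable {V : Type*}

/-- Two cycles that share a vertex have the same edges. -/
def CyclesMeetEqually (H : SimpleGraph V) : Prop :=
  ∀ ⦃u v z : V⦄ (C : H.Walk u u) (D : H.Walk v v), C.IsCycle → D.IsCycle → z ∈ C.support →
    z ∈ D.support → ∀ e ∈ D.edges, e ∈ C.edges

theorem Walk.IsCycle.exists_mem_edges {H : SimpleGraph V} {u z : V} {C : H.Walk u u}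
    (hC : C.IsCycle) (hz : z ∈ C.support) : ∃ y, s(z, y) ∈ C.edges := by
  classical
  have hC' := (Walk.isCycle_rotate hz).2 hC
  refine ⟨(C.rotate z hz).snd, ?_⟩
  exact (C.rotate_edges z hz).mem_iff.1 (Walk.mk_start_snd_mem_edges hC'.not_nil)

theorem pairwiseDisjointCycles_iff {H : SimpleGraph V} :
    H.PairwiseDisjointCycles ↔ H.CyclesMeetEqually := by
  constructor
  · intro h u v z C D hC hD hzC hzD e he
    by_contra hne
    have h1 : C.toSubgraph ≠ D.toSubgraph := by
      intro heq
      rw [← Walk.mem_edges_toSubgraph, ← heq, Walk.mem_edges_toSubgraph] at he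
      exact hne he
    exact Set.disjoint_left.1 (h u v C D hC hD h1) (C.mem_verts_toSubgraph.2 hzC)
      (D.mem_verts_toSubgraph.2 hzD)
  · intro h u v C D hC hD hne
    rw [Set.disjoint_left]
    intro z hzC hzD
    rw [Walk.mem_verts_toSubgraph] at hzC hzD
    have h1 : ∀ e, e ∈ C.edges ↔ e ∈ D.edges := fun e =>
      ⟨h D C hD hC hzD hzC e, h C D hC hD hzC hzD e⟩
    apply hne
    have h2 : ∀ a, a ∈ C.support ↔ a ∈ D.support := by
      intro a
      constructor
      · intro ha
        obtain ⟨b, hb⟩ := hC.exists_mem_edges ha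
        exact D.fst_mem_support_of_mem_edges ((h1 _).1 hb)
      · intro ha
        obtain ⟨b, hb⟩ := hD.exists_mem_edges ha
        exact C.fst_mem_support_of_mem_edges ((h1 _).2 hb)
    ext a b
    · rw [Walk.mem_verts_toSubgraph, Walk.mem_verts_toSubgraph, h2]
    · rw [← Subgraph.mem_edgeSet, ← Subgraph.mem_edgeSet, Walk.mem_edges_toSubgraph,
        Walk.mem_edges_toSubgraph, h1]

theorem Walk.IsCycle.exists_of_le {H G : SimpleGraph V} (hle : H ≤ G) {u : V} {C : H.Walk u u}
    (hC : C.IsCycle) : ∃ D : G.Walk u u, D.IsCycle ∧ D.edges = C.edges ∧ D.support = C.support :=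
  hC.exists_le fun _ he => edgeSet_mono hle (C.edges_subset_edgeSet he)

theorem CyclesMeetEqually.anti {H G : SimpleGraph V} (hG : G.CyclesMeetEqually) (hle : H ≤ G) :
    H.CyclesMeetEqually := by
  intro u v z C D hC hD hzC hzD e he
  obtain ⟨C', hC', h1, h2⟩ := hC.exists_of_le hle
  obtain ⟨D', hD', h3, h4⟩ := hD.exists_of_le hle
  rw [← h1]
  exact hG C' D' hC' hD' (h2 ▸ hzC) (h4 ▸ hzD) e (h3 ▸ he)

theorem cycleVertices_mono {H G : SimpleGraph V} (hle : H ≤ G) :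
    H.cycleVertices ⊆ G.cycleVertices := by
  rintro x ⟨u, C, hC, hx⟩
  obtain ⟨D, hD, -, h⟩ := hC.exists_of_le hle
  exact ⟨u, D, hD, h ▸ hx⟩

theorem Walk.exists_exit_edge {H : SimpleGraph V} {S : Set V} {E : Set (Sym2 V)}
    (hES : ∀ a b, s(a, b) ∈ E → b ∈ S) {z w : V} (p : H.Walk z w) (hz : z ∈ S)
    (hp : ∃ e ∈ p.edges, e ∉ E) : ∃ x y, s(x, y) ∈ p.edges ∧ s(x, y) ∉ E ∧ x ∈ S := by
  induction p with
  | nil => simp at hp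
  | @cons a b c hab p ih =>
    by_cases h : s(a, b) ∈ E
    · obtain ⟨e, he, heE⟩ := hp
      rw [Walk.edges_cons, List.mem_cons] at he
      have he' : e ∈ p.edges := he.resolve_left (by rintro rfl; exact heE h)
      obtain ⟨x, y, h1, h2⟩ := ih (hES a b h) ⟨e, he', heE⟩
      exact ⟨x, y, by simp [h1], h2⟩
    · exact ⟨a, b, by simp, h, hz⟩

/-- If `xy` is a bridge and some maximum matching misses `x`, then every maximum matching covers
`y`. -/
theorem matchingNumber_isolate_lt_of_bridge [Finite V] {H : SimpleGraph V} {x y : V}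
    (hxy : H.Adj x y) (hbr : ¬ (H.deleteEdges {s(x, y)}).Reachable x y)
    (hx : (H.isolate {x}).matchingNumber = H.matchingNumber) :
    (H.isolate {y}).matchingNumber < H.matchingNumber := by
  set D := H.deleteEdges {s(x, y)} with hD
  let HX : SimpleGraph V :=
    { Adj := fun a b => D.Adj a b ∧ D.Reachable x a
      symm := ⟨fun a b h => ⟨h.1.symm, h.2.trans h.1.reachable⟩⟩
      loopless := ⟨fun a h => h.1.ne rfl⟩ }
  let HY : SimpleGraph V :=
    { Adj := fun a b => D.Adj a b ∧ ¬ D.Reachable x a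
      symm := ⟨fun a b h => ⟨h.1.symm, fun h' => h.2 (h'.trans h.1.symm.reachable)⟩⟩
      loopless := ⟨fun a h => h.1.ne rfl⟩ }
  have hXH : HX ≤ H := fun a b h => deleteEdges_le _ h.1
  have hYH : HY ≤ H := fun a b h => deleteEdges_le _ h.1
  have hdis : ∀ v a b, HX.Adj v a → ¬ HY.Adj v b := fun v a b h h' => h'.2 h.2
  have h1 : (H.isolate {x}).matchingNumber ≤
      (HX.isolate {x}).matchingNumber + HY.matchingNumber := by
    refine (matchingNumber_mono ?_).trans (matchingNumber_sup_le _ _)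
    rintro a b ⟨hab, ha, hb⟩
    simp only [Set.mem_singleton_iff] at ha hb
    have hab' : D.Adj a b := by
      rw [hD, deleteEdges_adj]
      refine ⟨hab, fun h => ?_⟩
      rcases Sym2.eq_iff.1 h with ⟨rfl, rfl⟩ | ⟨rfl, rfl⟩
      · exact ha rfl
      · exact hb rfl
    by_cases h : D.Reachable x a
    · exact Or.inl ⟨⟨hab', h⟩, ha, hb⟩
    · exact Or.inr ⟨hab', h⟩
  have h2 : (H.isolate {y}).matchingNumber ≤
      HX.matchingNumber + (HY.isolate {y}).matchingNumber := by
    refine (matchingNumber_mono ?_).trans (matchingNumber_sup_le _ _)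
    rintro a b ⟨hab, ha, hb⟩
    simp only [Set.mem_singleton_iff] at ha hb
    have hab' : D.Adj a b := by
      rw [hD, deleteEdges_adj]
      refine ⟨hab, fun h => ?_⟩
      rcases Sym2.eq_iff.1 h with ⟨rfl, rfl⟩ | ⟨rfl, rfl⟩
      · exact hb rfl
      · exact ha rfl
    by_cases h : D.Reachable x a
    · exact Or.inl ⟨hab', h⟩
    · exact Or.inr ⟨⟨hab', h⟩, ha, hb⟩
  have h3 := matchingNumber_add_le hXH hYH hdis
  have h4 : (HX.isolate {x}).matchingNumber + (HY.isolate {y}).matchingNumber ≤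
      (HX.isolate {x} ⊔ HY.isolate {y}).matchingNumber :=
    matchingNumber_add_le le_sup_left le_sup_right fun v a b h h' => hdis v a b h.1 h'.1
  -- The bridge joins matchings of the two sides that miss `x` and `y`. Had both isolations kept the
  -- matching number, this would give a matching of `H` that is too large.
  have h5 : (HX.isolate {x} ⊔ HY.isolate {y}).matchingNumber + 1 ≤ H.matchingNumber := by
    refine matchingNumber_add_one_le
      (sup_le ((isolate_le _ _).trans hXH) ((isolate_le _ _).trans hYH)) hxy ?_ ?_
    · rintro a (h | h)
      · exact h.2.1 rfl
      · exact h.1.2 (Reachable.refl _)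
    · rintro a (h | h)
      · exact hbr h.1.2
      · exact h.2.1 rfl
  omega

variable [Fintype V]

/-- The positive index of the form of `H` attains its upper bound. -/
def IsTight (A : Matrix V V ℂ) (H : SimpleGraph V) : Prop :=
  (posIndex (energy A H) : ℤ) = H.matchingNumber + H.cyclomaticNumber

variable {A : Matrix V V ℂ} {H : SimpleGraph V}

theorem posIndex_energy_le_isolate_add_one (A : Matrix V V ℂ) (H : SimpleGraph V) (x : V) :
    posIndex (energy A H) ≤ posIndex (energy A (H.isolate {x})) + 1 := by
  have := posIndex_energy_le_add_card (A := A) (isolate_le H {x}) {x} fun a b hab => by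
    simp only [isolate_adj, Set.mem_singleton_iff, Finset.mem_singleton]; tauto
  simpa using this

/-- With H - x denoting the graph after isolation, m(H) + c(H) = p(H) ≤ p(H - x) + 1 ≤ m(H - x) +
c(H - x) + 1 ≤ m(H) + c(H), so every inequality is an equality. -/
theorem IsTight.isolate_of_mem_cycle (hH : IsTight A H) {x : V} (hx : x ∈ H.cycleVertices) :
    IsTight A (H.isolate {x}) ∧ (H.isolate {x}).matchingNumber = H.matchingNumber ∧
      (H.isolate {x}).cyclomaticNumber + 1 = H.cyclomaticNumber := by
  obtain ⟨u, C, hC, hxC⟩ := hx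
  have h1 := posIndex_energy_le_isolate_add_one A H x
  have h2 := posIndex_energy_le A (H.isolate {x})
  have h3 := cyclomaticNumber_isolate_lt hC hxC
  have h4 := matchingNumber_mono (isolate_le H {x})
  unfold IsTight at *
  omega

/-- The chain for a cycle vertex closes up again, but now the unit lost is a matching edge: a
maximum matching misses `x`, hence none misses `y`. -/
theorem IsTight.isolate_of_bridge (hH : IsTight A H) {x y : V} (hx : x ∈ H.cycleVertices)
    (hxy : H.Adj x y) (hbr : ¬ (H.deleteEdges {s(x, y)}).Reachable x y) :
    IsTight A (H.isolate {y}) ∧ (H.isolate {y}).matchingNumber + 1 = H.matchingNumber := by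
  have h0 := matchingNumber_isolate_lt_of_bridge hxy hbr (hH.isolate_of_mem_cycle hx).2.1
  have h1 := posIndex_energy_le_isolate_add_one A H y
  have h2 := posIndex_energy_le A (H.isolate {y})
  have h3 := cyclomaticNumber_mono (isolate_le H {y})
  unfold IsTight at *
  omega

theorem IsTight.not_mem_cycleVertices_of_bridge (hH : IsTight A H) {x y : V}
    (hx : x ∈ H.cycleVertices) (hxy : H.Adj x y)
    (hbr : ¬ (H.deleteEdges {s(x, y)}).Reachable x y) : y ∉ H.cycleVertices := by
  intro hy
  have h1 := (hH.isolate_of_bridge hx hxy hbr).2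
  have h2 := (hH.isolate_of_mem_cycle hy).2.1
  omega

/-- Otherwise `D` leaves `C` along an edge `xy` at a vertex `x` of `C`. Deleting that edge costs one
unit of the cyclomatic number, and isolating `x`, which is still on `C`, costs another; tightness
allows only one. -/
theorem IsTight.cyclesMeetEqually (hH : IsTight A H) : H.CyclesMeetEqually := by
  classical
  intro u v z C D hC hD hzC hzD e heD
  by_contra heC
  have hD' := (Walk.isCycle_rotate hzD).2 hD
  have hedges := fun e => (D.rotate_edges z hzD).mem_iff (a := e)
  obtain ⟨x, y, hxyD, hxyC, hxC⟩ := Walk.exists_exit_edge (S := {x | x ∈ C.support})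
    (E := {e | e ∈ C.edges}) (fun a b h => C.snd_mem_support_of_mem_edges h)
    (D.rotate z hzD) hzC ⟨e, (hedges e).2 heD, heC⟩
  have hxy : H.Adj x y := Walk.adj_of_mem_edges _ hxyD
  have h1 := cyclomaticNumber_deleteEdges_of_reachable hxy
    ((reachable_deleteEdges_iff_mem_cycle hxy).2 ⟨_, _, hD', hxyD⟩)
  obtain ⟨C', hC', -, hsupp⟩ := hC.exists_le (H' := H.deleteEdges {s(x, y)}) (by
    intro f hf
    rw [edgeSet_deleteEdges]
    exact ⟨C.edges_subset_edgeSet hf, by rintro rfl; exact hxyC hf⟩)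
  have h2 := cyclomaticNumber_isolate_lt hC' (x := x) (hsupp ▸ hxC)
  have h3 : (H.isolate {x}).cyclomaticNumber ≤
      ((H.deleteEdges {s(x, y)}).isolate {x}).cyclomaticNumber := by
    refine cyclomaticNumber_mono fun a b hab => ⟨?_, hab.2⟩
    rw [deleteEdges_adj]
    refine ⟨hab.1, fun h => ?_⟩
    rcases Sym2.eq_iff.1 h with ⟨rfl, rfl⟩ | ⟨rfl, rfl⟩
    · exact hab.2.1 rfl
    · exact hab.2.2 rfl
  have h4 := (hH.isolate_of_mem_cycle ⟨u, C, hC, hxC⟩).2.2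
  omega

/-- In a tight graph some set of as many vertices of cycles as the cyclomatic number is avoided by a
maximum matching. -/
theorem IsTight.exists_feedback (hH : IsTight A H) :
    ∃ S : Finset V, (S.card : ℤ) = H.cyclomaticNumber ∧ (∀ x ∈ S, x ∈ H.cycleVertices) ∧
      (H.isolate S).matchingNumber = H.matchingNumber := by
  classical
  induction hn : Nat.card H.edgeSet using Nat.strong_induction_on generalizing H with
  | _ n ih =>
    by_cases hac : H.IsAcyclic
    · exact ⟨∅, by simp [hac.cyclomaticNumber_eq_zero], by simp, by simp⟩
    · simp only [IsAcyclic, not_forall, not_not] at hac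
      obtain ⟨x, C, hC⟩ := hac
      have hx : x ∈ H.cycleVertices := ⟨x, C, hC, C.start_mem_support⟩
      obtain ⟨h1, h2, h3⟩ := hH.isolate_of_mem_cycle hx
      obtain ⟨S, hS, hSO, hm⟩ := ih _ (hn ▸ card_edgeSet_isolate_lt (Set.mem_singleton x)
        (C.adj_snd hC.not_nil)) h1 rfl
      have hxS : x ∉ S := by
        intro hxS
        obtain ⟨u, D, hD, hxD⟩ := hSO x hxS
        obtain ⟨y, hy⟩ := hD.exists_mem_edges hxD
        exact (D.adj_of_mem_edges hy).2.1 rfl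
      refine ⟨insert x S, ?_, ?_, ?_⟩
      · rw [Finset.card_insert_of_notMem hxS]
        push_cast
        omega
      · intro z hz
        rcases Finset.mem_insert.1 hz with rfl | hz
        · exact hx
        · exact cycleVertices_mono (isolate_le _ _) (hSO z hz)
      · rw [← h2, ← hm]
        congr 1
        ext a b
        simp
        tauto

/-- The vertices of `Y` are isolated one at a time. As `Y` avoids all cycles, every cycle survives,
and each edge to the next `y` is still a bridge at a cycle vertex. -/
theorem IsTight.isolate_neighbors (hH : IsTight A H) (Y : Finset V)
    (hY : ∀ y ∈ Y, y ∉ H.cycleVertices ∧ ∃ x ∈ H.cycleVertices, H.Adj x y) :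
    IsTight A (H.isolate Y) ∧ (H.isolate Y).matchingNumber + Y.card = H.matchingNumber := by
  classical
  induction Y using Finset.induction_on with
  | empty => simpa using hH
  | insert y Y hyY ih =>
    obtain ⟨h1, h2⟩ := ih fun z hz => hY z (Finset.mem_insert_of_mem hz)
    obtain ⟨hyO, x, ⟨u, C, hC, hxC⟩, hxy⟩ := hY y (Finset.mem_insert_self _ _)
    have hYC : ∀ a ∈ C.support, a ∉ Y := fun a ha haY =>
      (hY a (Finset.mem_insert_of_mem haY)).1 ⟨u, C, hC, ha⟩
    obtain ⟨C', hC', -, hsupp⟩ := hC.exists_le (H' := H.isolate Y) (by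
      intro e he
      induction e with
      | h a b => exact ⟨C.adj_of_mem_edges he, hYC a (C.fst_mem_support_of_mem_edges he),
          hYC b (C.snd_mem_support_of_mem_edges he)⟩)
    have hadj : (H.isolate Y).Adj x y := ⟨hxy, hYC x hxC, hyY⟩
    have := h1.isolate_of_bridge (x := x) ⟨u, C', hC', hsupp ▸ hxC⟩ hadj (by
      rw [reachable_deleteEdges_iff_mem_cycle hadj]
      rintro ⟨w, D, hD, hmem⟩
      exact hyO (cycleVertices_mono (isolate_le H Y)
        ⟨w, D, hD, D.snd_mem_support_of_mem_edges hmem⟩))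
    rw [Finset.coe_insert, isolate_insert, Finset.card_insert_of_notMem hyY]
    exact ⟨this.1, by omega⟩

end SimpleGraph

/-! ### The form of a weighted cycle -/

section CycleForm

/-- The Hermitian form of a cycle on `m + 1` vertices with weights `a 0, …, a (m - 1)` along a
spanning path and weight `g` on the closing edge. -/
noncomputable def cycleForm (m : ℕ) (a : ℕ → ℂ) (g : ℂ) (z : Fin (m + 1) → ℂ) : ℝ :=
  2 * (∑ i : Fin m, star (z i.castSucc) * a i * z i.succ + star (z (Fin.last m)) * g * z 0).re

@[simp]
theorem cycleForm_zero (m : ℕ) (a : ℕ → ℂ) (g : ℂ) : cycleForm m a g 0 = 0 := by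
  simp [cycleForm]

/-- The terms that contain the last two coordinates factor as a product of two linear forms, up to a
term joining coordinates `m` and 0. That term closes a shorter cycle, with weight `-(a m * a (m + 1)
* g)`. -/
theorem cycleForm_add_two (m : ℕ) (a : ℕ → ℂ) (g : ℂ) (ha : star (a (m + 1)) * a (m + 1) = 1)
    (z : Fin (m + 3) → ℂ) :
    cycleForm (m + 2) a g z =
      cycleForm m a (-(a m * a (m + 1) * g)) (fun i => z i.castSucc.castSucc) +
      2 * (star (a (m + 1) * z (Fin.last (m + 2)) + star (a m) * z (Fin.last m).castSucc.castSucc) *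
        (z (Fin.last (m + 1)).castSucc + a (m + 1) * g * z 0)).re := by
  simp only [cycleForm, Fin.sum_univ_castSucc, Fin.val_castSucc, Fin.val_last, Fin.succ_last,
    Fin.succ_castSucc, Fin.castSucc_zero]
  generalize ∑ i : Fin m, star (z i.castSucc.castSucc.castSucc) * a i *
    z i.succ.castSucc.castSucc = s
  generalize z (Fin.last m).castSucc.castSucc = z1
  generalize z (Fin.last (m + 1)).castSucc = z2
  generalize z (Fin.last (m + 2)) = z3
  generalize z 0 = z0
  generalize a m = b at *
  generalize a (m + 1) = c at *
  have h1 : (star c * star z3 * z2).re = (star z2 * c * z3).re := by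
    rw [← Complex.conj_re, ← starRingEnd_apply]
    simp only [RCLike.star_def, map_mul, Complex.conj_conj]
    congr 1
    ring
  have h2 : star (c * z3 + star b * z1) * (z2 + c * g * z0) = star c * star z3 * z2 +
      star z3 * g * z0 + star z1 * b * z2 + star z1 * (b * c * g) * z0 := by
    rw [star_add, star_mul, star_mul, star_star]
    linear_combination (star z3 * g * z0) * ha
  rw [h2]
  simp only [Complex.add_re, h1, mul_neg, neg_mul, Complex.neg_re]
  ring

theorem posIndex_cycleForm_add_two (m : ℕ) (a : ℕ → ℂ) (g : ℂ)
    (ha : star (a (m + 1)) * a (m + 1) = 1) :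
    posIndex (cycleForm (m + 2) a g) =
      posIndex (cycleForm m a (-(a m * a (m + 1) * g))) + 1 := by
  apply le_antisymm
  · have := posIndex_le_add_card (Q := cycleForm (m + 2) a g)
      (Q₁ := cycleForm m a (-(a m * a (m + 1) * g))) (ι := Unit)
      (LinearMap.pi fun _ => a (m + 1) • LinearMap.proj (Fin.last (m + 2)) +
        star (a m) • LinearMap.proj (Fin.last m).castSucc.castSucc)
      (LinearMap.funLeft ℂ ℂ fun i : Fin (m + 1) => (i.castSucc.castSucc : Fin (m + 3)))
      (by simp) (by
        intro w hw
        have h1 : a (m + 1) * w (Fin.last (m + 2)) +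
          star (a m) * w (Fin.last m).castSucc.castSucc = 0 := congrFun hw ()
        rw [cycleForm_add_two m a g ha, h1]
        simp [LinearMap.funLeft, Function.comp_def])
    simpa using this
  · have h1 : posIndex (fun t : ℂ => 2 * ‖t‖ ^ 2) = 1 := by
      rw [posIndex_pos_def fun w hw => by have := norm_pos_iff.2 hw; positivity,
        Module.finrank_self]
    refine le_trans (Nat.add_le_add_left h1.ge _) ?_
    -- The two new coordinates are solved for so that both linear factors equal `p.2`.
    let T : (Fin (m + 1) → ℂ) × ℂ →ₗ[ℂ] (Fin (m + 3) → ℂ) :=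
      { toFun := fun p => Fin.snoc (α := fun _ => ℂ) (Fin.snoc (α := fun _ => ℂ) p.1
          (p.2 - a (m + 1) * g * p.1 0))
          (star (a (m + 1)) * (p.2 - star (a m) * p.1 (Fin.last m)))
        map_add' := fun p q => by
          ext i
          refine Fin.lastCases ?_ (fun i => Fin.lastCases ?_ (fun i => ?_) i) i
          · simp; ring
          · simp; ring
          · simp
        map_smul' := fun c p => by
          ext i
          refine Fin.lastCases ?_ (fun i => Fin.lastCases ?_ (fun i => ?_) i) i
          · simp; ring
          · simp; ring
          · simp }
    refine posIndex_add_le T (by simp) (by simp) (by simp) fun x t => ?_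
    rw [cycleForm_add_two m a g ha]
    have hT0 : ∀ i : Fin (m + 1), T (x, t) i.castSucc.castSucc = x i := fun i => by simp [T]
    have hT1 : T (x, t) (Fin.last (m + 1)).castSucc = t - a (m + 1) * g * x 0 := by simp [T]
    have hT2 : T (x, t) (Fin.last (m + 2)) = star (a (m + 1)) * (t - star (a m) * x (Fin.last m)) := by
      simp [T]
    have hT3 : T (x, t) 0 = x 0 := hT0 0
    simp only [hT0, hT1, hT2, hT3]
    have h2 : a (m + 1) * (star (a (m + 1)) * (t - star (a m) * x (Fin.last m))) +
        star (a m) * x (Fin.last m) = t := by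
      rw [← mul_assoc, mul_comm (a (m + 1)), ha]; ring
    rw [h2, sub_add_cancel, RCLike.star_def, ← Complex.normSq_eq_conj_mul_self, Complex.ofReal_re,
      Complex.normSq_eq_norm_sq]

/-- Each elimination splits off one positive direction and changes the sign of the total product.
After `k` of them one vertex with a loop is left, with form `2 * g.re * ‖z 0‖ ^ 2` for the current
`g`; its sign decides. -/
theorem posIndex_cycleForm_even (k : ℕ) (a : ℕ → ℂ) (ha : ∀ i < 2 * k, star (a i) * a i = 1)
    (g : ℂ) : posIndex (cycleForm (2 * k) a g) =
      k + if 0 < ((-1) ^ k * ((∏ i ∈ Finset.range (2 * k), a i) * g)).re then 1 else 0 := by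
  induction k generalizing g with
  | zero =>
    have h1 : ∀ z, cycleForm 0 a g z = (2 * g.re) * ‖z 0‖ ^ 2 := by
      intro z
      rw [← Complex.normSq_eq_norm_sq, Complex.normSq_apply]
      simp [cycleForm]
      ring
    have := posIndex_diagonal (fun _ : Fin 1 => 2 * g.re)
    simp only [Finset.univ_unique, Fin.default_eq_zero, Finset.sum_singleton] at this
    rw [show cycleForm (2 * 0) a g = fun z : Fin 1 → ℂ => (2 * g.re) * ‖z 0‖ ^ 2 from funext h1,
      this]
    by_cases hg : 0 < g.re <;> simp [hg]
  | succ k ih =>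
    rw [show 2 * (k + 1) = 2 * k + 2 by ring, posIndex_cycleForm_add_two _ _ _ (ha _ (by omega)),
      ih (fun i hi => ha i (by omega)), Finset.prod_range_succ, Finset.prod_range_succ]
    have : (-1) ^ k * ((∏ i ∈ Finset.range (2 * k), a i) * -(a (2 * k) * a (2 * k + 1) * g)) =
      (-1) ^ (k + 1) * ((∏ i ∈ Finset.range (2 * k), a i) * a (2 * k) * a (2 * k + 1) * g) := by
      ring
    rw [this]
    ring

/-- Here elimination ends with two vertices joined by two edges, and that form vanishes when `w 0 =
0`. -/
theorem posIndex_cycleForm_odd_le (k : ℕ) (a : ℕ → ℂ) (ha : ∀ i < 2 * k + 1, star (a i) * a i = 1)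
    (g : ℂ) : posIndex (cycleForm (2 * k + 1) a g) ≤ k + 1 := by
  induction k generalizing g with
  | zero =>
    have := posIndex_le_card (Q := cycleForm (2 * 0 + 1) a g) (ι := Unit)
      (LinearMap.pi fun _ => LinearMap.proj 0) (by
        intro w hw
        have h1 : w 0 = 0 := congrFun hw ()
        simp [cycleForm, h1])
    simpa using this
  | succ k ih =>
    rw [show 2 * (k + 1) + 1 = (2 * k + 1) + 2 by ring,
      posIndex_cycleForm_add_two _ _ _ (ha _ (by omega))]
    have := ih (fun i hi => ha i (by omega)) (-(a (2 * k + 1) * a (2 * k + 1 + 1) * g))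
    omega

end CycleForm

/-! ### Cycles inside a graph -/

namespace SimpleGraph

variable {V : Type*}

/-- The graph whose edges are the edges of a walk. -/
def Walk.edgeGraph {H : SimpleGraph V} {u v : V} (p : H.Walk u v) : SimpleGraph V where
  Adj a b := s(a, b) ∈ p.edges
  symm := ⟨fun a b h => by rwa [Sym2.eq_swap]⟩
  loopless := ⟨fun _ h => (p.adj_of_mem_edges h).ne rfl⟩

@[simp]
theorem Walk.edgeGraph_adj {H : SimpleGraph V} {u v : V} (p : H.Walk u v) {a b : V} :
    p.edgeGraph.Adj a b ↔ s(a, b) ∈ p.edges := Iff.rfl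

theorem Walk.edgeGraph_le {H : SimpleGraph V} {u v : V} (p : H.Walk u v) : p.edgeGraph ≤ H :=
  fun _ _ h => p.adj_of_mem_edges h

theorem Walk.mk_getVert_succ_mem_edges {H : SimpleGraph V} {u v : V} (p : H.Walk u v) {i : ℕ}
    (hi : i < p.length) : s(p.getVert i, p.getVert (i + 1)) ∈ p.edges := by
  induction p generalizing i with
  | nil => simp at hi
  | cons h p ih =>
    cases i with
    | zero => simp
    | succ i =>
      rw [Walk.edges_cons]
      exact List.mem_cons_of_mem _ (ih (by simpa using hi))

/-- A cycle has at least `⌊n / 2⌋` pairwise disjoint edges. -/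
theorem Walk.IsCycle.length_div_two_le [Finite V] {H : SimpleGraph V} {u : V} {C : H.Walk u u}
    (hC : C.IsCycle) : C.length / 2 ≤ C.edgeGraph.matchingNumber := by
  classical
  have hinj := hC.getVert_injOn'
  have hv : ∀ i j, i < C.length → j < C.length → C.getVert i = C.getVert j → i = j :=
    fun i j hi hj h => hinj (by simp; omega) (by simp; omega) h
  have key : ∀ i j w, i < C.length / 2 → j < C.length / 2 →
      w ∈ s(C.getVert (2 * i), C.getVert (2 * i + 1)) →
      w ∈ s(C.getVert (2 * j), C.getVert (2 * j + 1)) → i = j := by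
    intro i j w hi hj h1 h2
    rcases Sym2.mem_iff.1 h1 with rfl | rfl <;> rcases Sym2.mem_iff.1 h2 with h | h <;>
      have := hv _ _ (by omega) (by omega) h <;> omega
  have hSinj : Set.InjOn (fun i => s(C.getVert (2 * i), C.getVert (2 * i + 1)))
      (Finset.range (C.length / 2) : Set ℕ) := by
    intro i hi j hj hij
    simp only [Finset.coe_range, Set.mem_Iio] at hi hj
    exact key i j (C.getVert (2 * i)) hi hj (by simp) (by simp only at hij; rw [← hij]; simp)
  rw [← Finset.card_range (C.length / 2), ← Finset.card_image_of_injOn hSinj]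
  apply IsEdgeMatching.card_le_matchingNumber
  · intro e he f hf w hwe hwf
    obtain ⟨i, hi, rfl⟩ := Finset.mem_image.1 he
    obtain ⟨j, hj, rfl⟩ := Finset.mem_image.1 hf
    rw [key i j w (by simpa using hi) (by simpa using hj) hwe hwf]
  · intro e he
    obtain ⟨i, hi, rfl⟩ := Finset.mem_image.1 (Finset.mem_coe.1 he)
    have hi' : i < C.length / 2 := by simpa using hi
    exact C.mk_getVert_succ_mem_edges (by omega)

theorem Walk.IsCycle.card_support [Fintype V] [DecidableEq V] {H : SimpleGraph V} {u : V}
    {C : H.Walk u u} (hC : C.IsCycle) : C.support.toFinset.card = C.length := by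
  have hpos := hC.three_le_length
  have himg : C.support.toFinset = (Finset.range C.length).image C.getVert := by
    ext v
    rw [List.mem_toFinset, Finset.mem_image, Walk.mem_support_iff_exists_getVert]
    constructor
    · rintro ⟨n, rfl, hn⟩
      rcases hn.lt_or_eq with hn | rfl
      · exact ⟨n, Finset.mem_range.2 hn, rfl⟩
      · exact ⟨0, Finset.mem_range.2 (by omega), by simp⟩
    · rintro ⟨n, hn, rfl⟩
      exact ⟨n, rfl, (Finset.mem_range.1 hn).le⟩
  rw [himg, Finset.card_image_of_injOn, Finset.card_range]
  intro i hi j hj hij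
  rw [Finset.coe_range, Set.mem_Iio] at hi hj
  exact hC.getVert_injOn' (by simp; omega) (by simp; omega) hij

theorem Walk.IsCycle.two_mul_matchingNumber_le [Fintype V] {H : SimpleGraph V} {u : V}
    {C : H.Walk u u} (hC : C.IsCycle) : 2 * C.edgeGraph.matchingNumber ≤ C.length := by
  classical
  obtain ⟨S, hS, hm, hc⟩ := exists_isEdgeMatching C.edgeGraph
  rw [← hc, ← hm.two_mul_card hS, ← hC.card_support]
  apply Finset.card_le_card
  intro v hv
  obtain ⟨e, he, hve⟩ := Finset.mem_biUnion.1 hv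
  rw [Sym2.mem_toFinset] at hve
  rw [List.mem_toFinset]
  obtain ⟨b, rfl⟩ := Sym2.mem_iff_exists.1 hve
  exact C.fst_mem_support_of_mem_edges (hS he)

/-- The product of the entries of a matrix along a walk. -/
noncomputable def Walk.matrixProd (A : Matrix V V ℂ) {H : SimpleGraph V} {u v : V}
    (p : H.Walk u v) : ℂ :=
  ∏ i ∈ Finset.range p.length, A (p.getVert i) (p.getVert (i + 1))

variable [Fintype V]

theorem Walk.IsTrail.energy_edgeGraph {A : Matrix V V ℂ} (hA : A.IsHermitian) {H : SimpleGraph V}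
    {u v : V} {p : H.Walk u v} (hp : p.IsTrail) (w : V → ℂ) :
    energy A p.edgeGraph w = ∑ i ∈ Finset.range p.length,
      2 * (star (w (p.getVert i)) * A (p.getVert i) (p.getVert (i + 1)) *
        w (p.getVert (i + 1))).re := by
  classical
  induction p with
  | nil => simp [energy]
  | @cons a b c hab p ih =>
    rw [Walk.isTrail_cons] at hp
    have hsup : (Walk.cons hab p).edgeGraph = edge a b ⊔ p.edgeGraph := by
      ext x y
      have hne : s(x, y) = s(a, b) → x ≠ y := by
        rintro h rfl
        have := Sym2.eq_iff.1 h
        exact hab.ne (by grind)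
      rw [Walk.edgeGraph_adj, Walk.edges_cons, List.mem_cons, sup_adj, Walk.edgeGraph_adj, edge_adj]
      have : s(x, y) = s(a, b) ↔ ((a = x ∧ b = y ∨ a = y ∧ b = x) ∧ x ≠ y) :=
        ⟨fun h => ⟨by have := Sym2.eq_iff.1 h; tauto, hne h⟩, fun h => Sym2.eq_iff.2 (by tauto)⟩
      rw [this]
      tauto
    have hedge : energy A (edge a b) w = 2 * (star (w a) * A a b * w b).re := by
      have hne := hab.ne
      have hterm : ∀ u v, (star (w u) * maskMatrix A (edge a b) u v * w v).re =
          (if u = a then if v = b then (star (w u) * A u v * w v).re else 0 else 0) +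
          (if u = b then if v = a then (star (w u) * A u v * w v).re else 0 else 0) := by
        intro u v
        simp only [maskMatrix, Matrix.of_apply]
        by_cases h : (edge a b).Adj u v
        · rw [if_pos h]
          rw [edge_adj] at h
          rcases h.1 with ⟨rfl, rfl⟩ | ⟨rfl, rfl⟩
          · simp [hne]
          · simp [hne.symm]
        · rw [if_neg h]
          rw [edge_adj] at h
          by_cases hua : u = a
          · subst hua
            by_cases hvb : v = b
            · exact (h ⟨Or.inl ⟨rfl, hvb⟩, fun h' => hne (h'.trans hvb)⟩).elim
            · simp [hvb, hne]
          · by_cases hub : u = b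
            · subst hub
              by_cases hva : v = a
              · exact (h ⟨Or.inr ⟨rfl, hva⟩, fun h' => hne (h'.trans hva).symm⟩).elim
              · simp [hva, hua]
            · simp [hua, hub]
      have hsymm : (star (w b) * A b a * w a).re = (star (w a) * A a b * w b).re := by
        rw [← hA.apply a b, ← Complex.conj_re, ← starRingEnd_apply]
        simp only [RCLike.star_def, map_mul, Complex.conj_conj]
        congr 1
        ring
      rw [energy_eq_sum_maskMatrix]
      simp only [hterm, Finset.sum_add_distrib, Finset.sum_ite_eq', Finset.mem_univ, if_true,
        Finset.sum_ite_irrel, Finset.sum_const_zero, hsymm]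
      ring
    have hdis : ∀ x y, (edge a b).Adj x y → ¬ p.edgeGraph.Adj x y := by
      intro x y h h'
      rw [edge_adj] at h
      apply hp.2
      have : s(a, b) = s(x, y) := Sym2.eq_iff.2 (by tauto)
      rw [this]
      exact h'
    rw [hsup, energy_sup _ hdis, ih hp.1, hedge, Walk.length_cons, Finset.sum_range_succ']
    simp
    ring

theorem Walk.IsCycle.posIndex_energy {A : Matrix V V ℂ} (hA : A.IsHermitian) {H : SimpleGraph V}
    {u : V} {C : H.Walk u u} (hC : C.IsCycle) {m : ℕ} (hm : C.length = m + 1) :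
    posIndex (energy A C.edgeGraph) =
      posIndex (cycleForm m (fun i => A (C.getVert i) (C.getVert (i + 1)))
        (A (C.getVert m) (C.getVert (m + 1)))) := by
  classical
  have hinj : Function.Injective (fun i : Fin (m + 1) => C.getVert i) := by
    intro i j hij
    exact Fin.ext (hC.getVert_injOn' (by simp; omega) (by simp; omega) hij)
  have hform : ∀ w : V → ℂ, energy A C.edgeGraph w =
      cycleForm m (fun i => A (C.getVert i) (C.getVert (i + 1)))
        (A (C.getVert m) (C.getVert (m + 1))) (fun i => w (C.getVert i)) := by
    intro w
    rw [hC.isTrail.energy_edgeGraph hA, hm, Finset.sum_range_succ, cycleForm, Complex.add_re,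
      Complex.re_sum, ← Finset.mul_sum, ← mul_add, Finset.sum_range]
    have h0 : C.getVert (m + 1) = C.getVert 0 := by
      rw [← hm, Walk.getVert_length, Walk.getVert_zero]
    simp [h0]
  apply le_antisymm
  · exact posIndex_le_of_le (LinearMap.funLeft ℂ ℂ fun i : Fin (m + 1) => C.getVert i) (by simp)
      fun w => (hform w).le
  · refine posIndex_le_of_le (Function.ExtendByZero.linearMap ℂ
      (fun i : Fin (m + 1) => C.getVert i)) (by simp) fun z => ?_
    rw [hform]
    refine (congrArg _ (funext fun i => ?_)).le
    exact (hinj.extend_apply _ _ i).symm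

/-- A cycle of length `n` is of Type C for `A` if `n` is odd and the product of the entries of `A`
along it has positive real part after multiplication by `(-1) ^ ((n - 1) / 2)`. -/
def Walk.IsTypeC (A : Matrix V V ℂ) {H : SimpleGraph V} {u : V} (C : H.Walk u u) : Prop :=
  Odd C.length ∧ 0 < ((-1 : ℂ) ^ ((C.length - 1) / 2) * C.matrixProd A).re

theorem Walk.IsCycle.posIndex_of_isTypeC {A : Matrix V V ℂ} (hA : A.IsHermitian)
    {H : SimpleGraph V} {u : V} {C : H.Walk u u} (hC : C.IsCycle)
    (hu : ∀ a b, H.Adj a b → star (A a b) * A a b = 1) (ht : C.IsTypeC A) :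
    C.edgeGraph.matchingNumber + 1 ≤ posIndex (energy A C.edgeGraph) := by
  obtain ⟨⟨k, hk⟩, hpos⟩ := ht
  rw [hC.posIndex_energy hA hk, posIndex_cycleForm_even k _
    (fun i hi => hu _ _ (C.adj_getVert_succ (by omega))), if_pos]
  · have := hC.two_mul_matchingNumber_le
    omega
  · rw [Walk.matrixProd, hk, Finset.prod_range_succ, show (2 * k + 1 - 1) / 2 = k by omega] at hpos
    exact hpos

/-- A cycle of even length 2k has matching number at least k and index at most k. An odd one of
length 2k + 1 that fails the sign condition has index exactly k, again no more than its matching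
number. -/
theorem Walk.IsCycle.isTypeC_of_lt {A : Matrix V V ℂ} (hA : A.IsHermitian)
    {H : SimpleGraph V} {u : V} {C : H.Walk u u} (hC : C.IsCycle)
    (hu : ∀ a b, H.Adj a b → star (A a b) * A a b = 1)
    (hlt : C.edgeGraph.matchingNumber < posIndex (energy A C.edgeGraph)) : C.IsTypeC A := by
  have h1 := hC.length_div_two_le
  have h3 := hC.three_le_length
  rcases Nat.even_or_odd' C.length with ⟨k, hk | hk⟩
  · obtain ⟨j, rfl⟩ : ∃ j, k = j + 1 := ⟨k - 1, by omega⟩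
    rw [hC.posIndex_energy hA (show C.length = 2 * j + 1 + 1 by omega)] at hlt
    have := posIndex_cycleForm_odd_le j (fun i => A (C.getVert i) (C.getVert (i + 1)))
      (fun i hi => hu _ _ (C.adj_getVert_succ (by omega)))
      (A (C.getVert (2 * j + 1)) (C.getVert (2 * j + 1 + 1)))
    omega
  · refine ⟨⟨k, hk⟩, ?_⟩
    rw [hC.posIndex_energy hA hk, posIndex_cycleForm_even k _
      (fun i hi => hu _ _ (C.adj_getVert_succ (by omega)))] at hlt
    by_contra hneg
    rw [if_neg] at hlt
    · omega
    · rw [Walk.matrixProd, hk, Finset.prod_range_succ,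
        show (2 * k + 1 - 1) / 2 = k by omega] at hneg
      exact hneg

end SimpleGraph

/-! ### Unions of disjoint cycles -/

namespace SimpleGraph

variable {V : Type*}

/-- The graph formed by the edges of `H` that lie on cycles. -/
def cyclePart (H : SimpleGraph V) : SimpleGraph V where
  Adj a b := ∃ (u : V) (C : H.Walk u u), C.IsCycle ∧ s(a, b) ∈ C.edges
  symm := ⟨fun a b h => by rwa [Sym2.eq_swap]⟩
  loopless := ⟨fun _ ⟨_, C, _, h⟩ => (C.adj_of_mem_edges h).ne rfl⟩

theorem cyclePart_le (H : SimpleGraph V) : H.cyclePart ≤ H :=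
  fun _ _ ⟨_, C, _, h⟩ => C.adj_of_mem_edges h

theorem cyclePart_adj_left {H : SimpleGraph V} {a b : V} (h : H.cyclePart.Adj a b) :
    a ∈ H.cycleVertices := by
  obtain ⟨u, C, hC, hm⟩ := h
  exact ⟨u, C, hC, C.fst_mem_support_of_mem_edges hm⟩

theorem exists_cyclePart_adj {H : SimpleGraph V} {a : V} (h : a ∈ H.cycleVertices) :
    ∃ b, H.cyclePart.Adj a b := by
  obtain ⟨u, C, hC, hm⟩ := h
  obtain ⟨b, hb⟩ := hC.exists_mem_edges hm
  exact ⟨b, u, C, hC, hb⟩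

theorem not_reachable_of_not_cyclePart_adj {H : SimpleGraph V} {a b : V} (hab : H.Adj a b)
    (h : ¬ H.cyclePart.Adj a b) : ¬ (H.deleteEdges {s(a, b)}).Reachable a b := by
  rwa [reachable_deleteEdges_iff_mem_cycle hab]

theorem cyclePart_cyclePart (H : SimpleGraph V) : H.cyclePart.cyclePart = H.cyclePart := by
  refine le_antisymm (cyclePart_le _) ?_
  rintro a b ⟨u, C, hC, hm⟩
  obtain ⟨D, hD, h1, h2⟩ := hC.exists_le (H' := H.cyclePart) (by
    intro e he
    induction e with
    | h x y => exact ⟨u, C, hC, he⟩)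
  exact ⟨u, D, hD, h1 ▸ hm⟩

theorem cyclomaticNumber_cyclePart [Finite V] (H : SimpleGraph V) :
    H.cyclePart.cyclomaticNumber = H.cyclomaticNumber :=
  cyclomaticNumber_eq_of_not_reachable (cyclePart_le H) fun _ _ hab h =>
    not_reachable_of_not_cyclePart_adj hab h

/-- If two cycles that meet are equal, then an edge at a vertex of a cycle that lies on some cycle
belongs to the given one. -/
theorem CyclesMeetEqually.mem_edges {H : SimpleGraph V} (hH : H.CyclesMeetEqually) {u x y : V}
    {C : H.Walk u u} (hC : C.IsCycle) (hx : x ∈ C.support) (hxy : H.cyclePart.Adj x y) :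
    s(x, y) ∈ C.edges := by
  obtain ⟨v, D, hD, hm⟩ := hxy
  exact hH C D hC hD hx (D.fst_mem_support_of_mem_edges hm) _ hm

/-- Induction on graphs that are vertex-disjoint unions of cycles. -/
theorem CyclesMeetEqually.induction [Finite V] {P : SimpleGraph V → Prop} (hbot : P ⊥)
    (step : ∀ (H R : SimpleGraph V) (u : V) (C : H.Walk u u), C.IsCycle → H = C.edgeGraph ⊔ R →
      (∀ v a b, C.edgeGraph.Adj v a → ¬ R.Adj v b) →
      R.cyclomaticNumber + 1 = H.cyclomaticNumber → P R → P H)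
    {H : SimpleGraph V} (hH : H.CyclesMeetEqually) (hcyc : H.cyclePart = H) : P H := by
  induction hn : Nat.card H.edgeSet using Nat.strong_induction_on generalizing H with
  | _ n ih =>
    by_cases hb : H = ⊥
    · exact hb ▸ hbot
    obtain ⟨a, b, hab⟩ : ∃ a b, H.Adj a b := by
      by_contra! hcon
      exact hb (by ext a b; simp [hcon a b])
    obtain ⟨u, C, hC, hm⟩ : H.cyclePart.Adj a b := hcyc.symm ▸ hab
    set R := H.deleteEdges {e | e ∈ C.edges} with hR
    have hRadj : ∀ x y, R.Adj x y ↔ H.Adj x y ∧ s(x, y) ∉ C.edges := by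
      intro x y; simp [hR]
    have hRle : R ≤ H := deleteEdges_le _
    have hdis : ∀ v a b, C.edgeGraph.Adj v a → ¬ R.Adj v b := by
      intro v x y hvx hvy
      rw [hRadj] at hvy
      exact hvy.2 (hH.mem_edges hC (C.fst_mem_support_of_mem_edges hvx) (hcyc.symm ▸ hvy.1))
    have hRcyc : R.cyclePart = R := by
      refine le_antisymm (cyclePart_le _) fun x y hxy => ?_
      obtain ⟨v, D, hD, hmD⟩ : H.cyclePart.Adj x y := hcyc.symm ▸ hRle hxy
      obtain ⟨D', hD', h1, -⟩ := hD.exists_le (H' := R) (by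
        intro e he
        induction e with
        | h p q =>
          refine (hRadj p q).2 ⟨D.adj_of_mem_edges he, fun hpq => ((hRadj x y).1 hxy).2 ?_⟩
          exact hH C D hC hD (C.fst_mem_support_of_mem_edges hpq)
            (D.fst_mem_support_of_mem_edges he) _ hmD)
      exact ⟨v, D', hD', h1 ▸ hmD⟩
    refine step H R u C hC ?_ hdis ?_ (ih _ ?_ (hH.anti hRle) hRcyc rfl)
    · ext x y
      rw [sup_adj, hRadj, Walk.edgeGraph_adj]
      refine ⟨fun h => ?_, fun h => h.elim (fun h => C.adj_of_mem_edges h) fun h => h.1⟩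
      by_cases hxy : s(x, y) ∈ C.edges
      · exact Or.inl hxy
      · exact Or.inr ⟨h, hxy⟩
    · have h1 := cyclomaticNumber_deleteEdges_of_reachable hab
        ((reachable_deleteEdges_iff_mem_cycle hab).2 ⟨u, C, hC, hm⟩)
      have hRle' : R ≤ H.deleteEdges {s(a, b)} :=
        le_deleteEdges_singleton hRle fun h => ((hRadj a b).1 h).2 hm
      -- Once `ab` is deleted, no other edge of `C` lies on a cycle: such a cycle would meet `C` and
      -- hence contain `ab`.
      have h2 : R.cyclomaticNumber = (H.deleteEdges {s(a, b)}).cyclomaticNumber := by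
        refine cyclomaticNumber_eq_of_not_reachable hRle' fun x y hxy hnxy h => ?_
        have hxyC : s(x, y) ∈ C.edges := by
          by_contra hcon
          exact hnxy ((hRadj x y).2 ⟨deleteEdges_le _ hxy, hcon⟩)
        obtain ⟨v, D, hD, hmD⟩ := (reachable_deleteEdges_iff_mem_cycle hxy).1 h
        obtain ⟨D', hD', h3, h4⟩ := hD.exists_of_le (deleteEdges_le {s(a, b)})
        have h5 := hH D' C hD' hC (h4 ▸ D.fst_mem_support_of_mem_edges hmD)
          (C.fst_mem_support_of_mem_edges hxyC) _ hm
        rw [h3] at h5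
        have := D.edges_subset_edgeSet h5
        simp at this
      omega
    · rw [← hn, Nat.card_coe_set_eq, Nat.card_coe_set_eq]
      apply Set.ncard_lt_ncard _ (Set.toFinite _)
      refine ⟨edgeSet_mono hRle, fun h => ?_⟩
      exact ((hRadj a b).1 (h (show s(a, b) ∈ H.edgeSet from hab))).2 hm

theorem Walk.IsTypeC.congr {A : Matrix V V ℂ} {H G : SimpleGraph V} {u : V} {C : H.Walk u u}
    {D : G.Walk u u} (hC : C.IsTypeC A) (h : C.support = D.support) : D.IsTypeC A := by
  have hlen : C.length = D.length := by
    have := congrArg List.length h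
    simpa using this
  have hget : ∀ i ≤ C.length, C.getVert i = D.getVert i := by
    intro i hi
    rw [Walk.getVert_eq_getD_support, Walk.getVert_eq_getD_support, h]
  have hprod : C.matrixProd A = D.matrixProd A := by
    unfold Walk.matrixProd
    rw [← hlen]
    refine Finset.prod_congr rfl fun i hi => ?_
    have := Finset.mem_range.1 hi
    rw [hget i (by omega), hget (i + 1) (by omega)]
  unfold Walk.IsTypeC at *
  rwa [← hlen, ← hprod]

variable [Fintype V]

/-- A cycle of length n has n ≤ 2⌊n / 2⌋ + 1 vertices; the extra 1 is its share of the cyclomatic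
number. -/
theorem CyclesMeetEqually.card_le {H : SimpleGraph V} (hH : H.CyclesMeetEqually)
    (hcyc : H.cyclePart = H) (K : Finset V) (hK : ∀ x ∈ K, ∃ y, H.Adj x y) :
    (K.card : ℤ) ≤ 2 * H.matchingNumber + H.cyclomaticNumber := by
  classical
  refine hH.induction (P := fun H => ∀ K : Finset V, (∀ x ∈ K, ∃ y, H.Adj x y) →
    (K.card : ℤ) ≤ 2 * H.matchingNumber + H.cyclomaticNumber) ?_ ?_ hcyc K hK
  · intro K hK
    have : K = ∅ := Finset.eq_empty_of_forall_notMem fun x hx => (hK x hx).elim fun y hy => hy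
    simp [this]
  · intro H R u C hC hsup hdis hc ih K hK
    have h1 := ih (K.filter fun x => ∃ y, R.Adj x y) fun x hx => (Finset.mem_filter.1 hx).2
    have h2 : (K.filter fun x => ¬ ∃ y, R.Adj x y) ⊆ C.support.toFinset := by
      intro x hx
      obtain ⟨hxK, hxR⟩ := Finset.mem_filter.1 hx
      obtain ⟨y, hy⟩ := hK x hxK
      rw [hsup] at hy
      rcases hy with hy | hy
      · exact List.mem_toFinset.2 (C.fst_mem_support_of_mem_edges hy)
      · exact (hxR ⟨y, hy⟩).elim
    have h3 := Finset.card_le_card h2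
    rw [hC.card_support] at h3
    have h4 := Finset.card_filter_add_card_filter_not (s := K) (fun x => ∃ y, R.Adj x y)
    have h5 : C.edgeGraph.matchingNumber + R.matchingNumber ≤ H.matchingNumber :=
      matchingNumber_add_le C.edgeGraph_le (hsup ▸ le_sup_right) hdis
    have h6 := hC.length_div_two_le
    omega

theorem CyclesMeetEqually.matchingNumber_add_le {A : Matrix V V ℂ} (hA : A.IsHermitian)
    {H : SimpleGraph V} (hH : H.CyclesMeetEqually) (hcyc : H.cyclePart = H)
    (hu : ∀ a b, H.Adj a b → star (A a b) * A a b = 1)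
    (hC : ∀ (u : V) (C : H.Walk u u), C.IsCycle → C.IsTypeC A) :
    (H.matchingNumber : ℤ) + H.cyclomaticNumber ≤ posIndex (energy A H) := by
  refine hH.induction (P := fun H => (∀ a b, H.Adj a b → star (A a b) * A a b = 1) →
    (∀ (u : V) (C : H.Walk u u), C.IsCycle → C.IsTypeC A) →
    (H.matchingNumber : ℤ) + H.cyclomaticNumber ≤ posIndex (energy A H)) (by simp) ?_ hcyc hu hC
  intro H R u C hC hsup hdis hc ih hu hT
  have hRle : R ≤ H := hsup ▸ le_sup_right
  have h1 := ih (fun a b hab => hu a b (hRle hab)) (by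
    intro v D hD
    obtain ⟨D', hD', -, hs⟩ := hD.exists_of_le hRle
    exact (hT v D' hD').congr hs)
  have h2 := hC.posIndex_of_isTypeC hA hu (hT u C hC)
  have h3 := posIndex_energy_add_le (A := A) hdis
  have h4 := matchingNumber_sup_le C.edgeGraph R
  rw [← hsup] at h3 h4
  omega

/-- In a tight graph all cycles are of Type C. -/
theorem IsTight.isTypeC {A : Matrix V V ℂ} (hA : A.IsHermitian) {H : SimpleGraph V}
    (hH : IsTight A H) (hu : ∀ a b, H.Adj a b → star (A a b) * A a b = 1) {u : V}
    {C : H.Walk u u} (hC : C.IsCycle) : C.IsTypeC A := by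
  classical
  induction hn : Nat.card H.edgeSet using Nat.strong_induction_on generalizing H with
  | _ n ih =>
    have hO : ∀ x ∈ C.support, x ∈ H.cycleVertices := fun x hx => ⟨u, C, hC, hx⟩
    -- Edges leaving `C` are bridges whose far ends can be isolated without losing tightness, so
    -- eventually `C` is a whole component.
    by_cases hex : ∃ x y, x ∈ C.support ∧ H.Adj x y ∧ s(x, y) ∉ C.edges
    · obtain ⟨x, y, hx, hxy, hnot⟩ := hex
      have hbr := not_reachable_of_not_cyclePart_adj hxy
        fun h => hnot (hH.cyclesMeetEqually.mem_edges hC hx h)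
      have hy := hH.not_mem_cycleVertices_of_bridge (hO x hx) hxy hbr
      have hyC : ∀ a ∈ C.support, a ∉ ({y} : Set V) := by
        rintro a ha rfl
        exact hy (hO a ha)
      obtain ⟨C', hC', -, hs⟩ := hC.exists_le (H' := H.isolate {y}) (by
        intro e he
        induction e with
        | h a b => exact ⟨C.adj_of_mem_edges he, hyC a (C.fst_mem_support_of_mem_edges he),
            hyC b (C.snd_mem_support_of_mem_edges he)⟩)
      exact (ih _ (hn ▸ card_edgeSet_isolate_lt (Set.mem_singleton y) hxy.symm)
        (hH.isolate_of_bridge (hO x hx) hxy hbr).1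
        (fun a b hab => hu a b (isolate_le _ _ hab)) hC' rfl).congr hs
    · push Not at hex
      apply hC.isTypeC_of_lt hA hu
      set R := H.deleteEdges {e | e ∈ C.edges} with hR
      have hRadj : ∀ x y, R.Adj x y ↔ H.Adj x y ∧ s(x, y) ∉ C.edges := by
        intro x y; simp [hR]
      have hdis : ∀ v a b, C.edgeGraph.Adj v a → ¬ R.Adj v b := by
        intro v x y hvx hvy
        rw [hRadj] at hvy
        exact hvy.2 (hex v y (C.fst_mem_support_of_mem_edges hvx) hvy.1)
      -- Covering the rest `R` bounds its contribution by m(R) + c(R) ≤ m(H) - m(C) + c(H) - 1, so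
      -- tightness leaves index at least m(C) + 1 for `C`.
      obtain ⟨K, hK, hcov⟩ := exists_cover_card_le R
      have h1 := posIndex_energy_le_add_card (A := A) C.edgeGraph_le K (by
        intro a b hab
        by_cases h : s(a, b) ∈ C.edges
        · exact Or.inl h
        · exact Or.inr (hcov a b ((hRadj a b).2 ⟨hab, h⟩)))
      have h2 : C.edgeGraph.matchingNumber + R.matchingNumber ≤ H.matchingNumber :=
        matchingNumber_add_le C.edgeGraph_le (deleteEdges_le _) hdis
      have hadj := C.adj_snd hC.not_nil
      have hmem := Walk.mk_start_snd_mem_edges hC.not_nil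
      have h3 := cyclomaticNumber_lt_of_cycle (H' := R) (deleteEdges_le _) hadj
        (fun h => ((hRadj _ _).1 h).2 hmem)
        ((reachable_deleteEdges_iff_mem_cycle hadj).2 ⟨u, C, hC, hmem⟩)
      unfold IsTight at hH
      omega

end SimpleGraph

/-! ### Contracting the cycles -/

namespace SimpleGraph

variable {V : Type*}

/-- Identified vertices are joined by a chain of cycles, and no cycle uses an edge outside the cycle
part. So such an edge never becomes a loop of the contraction. -/
theorem reachable_of_mk_eq {G : SimpleGraph V} {a b x y : V} (hxy : ¬ G.cyclePart.Adj x y)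
    (h : (Quotient.mk G.cycleSetoid a) = Quotient.mk G.cycleSetoid b) :
    (G.deleteEdges {s(x, y)}).Reachable a b := by
  classical
  have h' : Relation.EqvGen _ a b := Quotient.exact h
  induction h' with
  | rel v w hr =>
    obtain ⟨u, C, hC, hv, hw⟩ := hr
    obtain ⟨D, -, -, hs⟩ := hC.exists_le (H' := G.deleteEdges {s(x, y)}) (by
      intro e he
      rw [edgeSet_deleteEdges]
      exact ⟨C.edges_subset_edgeSet he, by rintro rfl; exact hxy ⟨u, C, hC, he⟩⟩)
    exact (D.takeUntil v (hs ▸ hv)).reachable.symm.trans (D.takeUntil w (hs ▸ hw)).reachable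
  | refl => exact Reachable.refl _
  | symm v w hr ih => exact (ih (Quotient.sound hr)).symm
  | trans u v w hr hr' ih ih' => exact (ih (Quotient.sound hr)).trans (ih' (Quotient.sound hr'))

theorem eq_of_mk_eq {G : SimpleGraph V} {a b : V} (ha : a ∉ G.cycleVertices)
    (h : (Quotient.mk G.cycleSetoid a) = Quotient.mk G.cycleSetoid b) : a = b := by
  have h' : Relation.EqvGen _ a b := Quotient.exact h
  have key : a = b ∨ (a ∈ G.cycleVertices ∧ b ∈ G.cycleVertices) := by
    clear h ha
    induction h' with
    | rel v w hr =>
      obtain ⟨u, C, hC, hv, hw⟩ := hr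
      exact Or.inr ⟨⟨u, C, hC, hv⟩, ⟨u, C, hC, hw⟩⟩
    | refl => exact Or.inl rfl
    | symm v w hr ih => exact ih.imp Eq.symm And.symm
    | trans u v w hr hr' ih ih' =>
      rcases ih with rfl | ih
      · exact ih'
      · rcases ih' with rfl | ih'
        · exact Or.inr ih
        · exact Or.inr ⟨ih.1, ih'.2⟩
  exact key.resolve_right fun h => ha h.1

theorem mk_ne_mk {G : SimpleGraph V} {a b : V} (hab : G.Adj a b) (h : ¬ G.cyclePart.Adj a b) :
    (Quotient.mk G.cycleSetoid a) ≠ Quotient.mk G.cycleSetoid b :=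
  fun heq => not_reachable_of_not_cyclePart_adj hab h (reachable_of_mk_eq h heq)

theorem not_cyclePart_adj_of_mk_ne {G : SimpleGraph V} {a b : V}
    (h : (Quotient.mk G.cycleSetoid a) ≠ Quotient.mk G.cycleSetoid b) :
    ¬ G.cyclePart.Adj a b := by
  rintro ⟨u, C, hC, hm⟩
  exact h (Quotient.sound (Relation.EqvGen.rel _ _
    ⟨u, C, hC, C.fst_mem_support_of_mem_edges hm, C.snd_mem_support_of_mem_edges hm⟩))

/-- A walk in the contraction avoiding the image of `ab` lifts to `G` without `ab`, the gaps inside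
classes being filled along cycles. As `ab` lies on no cycle, it cannot join `a` to `b`. -/
theorem isAcyclic_contractCycles (G : SimpleGraph V) : G.contractCycles.IsAcyclic := by
  rw [isAcyclic_iff_forall_adj_isBridge]
  rintro _ _ ⟨hne, a, b, hab, rfl, rfl⟩
  have hcp := not_cyclePart_adj_of_mk_ne hne
  rw [isBridge_iff]
  rintro ⟨p⟩
  have key : ∀ {q q'} (p : (G.contractCycles.deleteEdges
      {s(Quotient.mk G.cycleSetoid a, Quotient.mk G.cycleSetoid b)}).Walk q q') (c c' : V),
      Quotient.mk G.cycleSetoid c = q → Quotient.mk G.cycleSetoid c' = q' →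
      (G.deleteEdges {s(a, b)}).Reachable c c' := by
    intro q q' p
    induction p with
    | nil =>
      intro c c' hc hc'
      exact reachable_of_mk_eq hcp (hc.trans hc'.symm)
    | @cons q r q' h p ih =>
      intro c c' hc hc'
      obtain ⟨⟨-, x, y, hxy, rfl, rfl⟩, h2⟩ := deleteEdges_adj.1 h
      refine ((reachable_of_mk_eq hcp hc).trans (Adj.reachable ?_)).trans (ih y c' rfl hc')
      rw [deleteEdges_adj]
      refine ⟨hxy, fun hs => h2 ?_⟩
      have := congrArg (Sym2.map (Quotient.mk G.cycleSetoid)) (Set.mem_singleton_iff.1 hs)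
      simpa using this
  exact not_reachable_of_not_cyclePart_adj hab hcp (key p a b rfl rfl)

theorem matchingNumber_induce_compl [Finite V] (G : SimpleGraph V) (s : Set V) :
    (G.induce sᶜ).matchingNumber = (G.isolate s).matchingNumber := by
  have : (G.induce sᶜ).map Subtype.val = G.isolate s := by
    ext a b
    constructor
    · rintro ⟨-, x, y, hxy, rfl, rfl⟩
      exact ⟨hxy, x.2, y.2⟩
    · rintro ⟨hab, ha, hb⟩
      exact ⟨hab.ne, ⟨a, ha⟩, ⟨b, hb⟩, hab, rfl, rfl⟩
  rw [← this]
  exact le_antisymm (matchingNumber_le_map Subtype.val_injective _) (matchingNumber_map_le _ _)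

theorem matchingNumber_induce_le_contractCycles [Finite V] (G : SimpleGraph V) :
    (G.induce G.cycleVerticesᶜ).matchingNumber ≤ G.contractCycles.matchingNumber := by
  have hinj : Function.Injective
      (fun x : (G.cycleVerticesᶜ : Set V) => Quotient.mk G.cycleSetoid x.1) :=
    fun x y h => Subtype.ext (eq_of_mk_eq x.2 h)
  refine (matchingNumber_le_map hinj _).trans (matchingNumber_mono ?_)
  rintro _ _ ⟨hne, x, y, hxy, rfl, rfl⟩
  exact ⟨hne, x, y, hxy, rfl, rfl⟩

variable [Fintype V]

theorem IsTight.matchingNumber_contractCycles_le {A : Matrix V V ℂ} {G : SimpleGraph V}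
    (hG : IsTight A G) :
    G.contractCycles.matchingNumber ≤ (G.isolate G.cycleVertices).matchingNumber := by
  classical
  set O := G.cycleVertices with hO
  let Y : Finset V := Finset.univ.filter fun y => y ∉ O ∧ ∃ x ∈ O, G.Adj x y
  have hY : ∀ y, y ∈ Y ↔ y ∉ O ∧ ∃ x ∈ O, G.Adj x y := fun y => by simp [Y]
  have hYm := (hG.isolate_neighbors Y fun y hy => (hY y).1 hy).2
  -- an edge leaving a cycle ends in `Y`
  have hexit : ∀ a b, G.Adj a b → ¬ G.cyclePart.Adj a b → a ∈ O → b ∈ Y := fun a b hab hn ha =>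
    (hY b).2 ⟨hG.not_mem_cycleVertices_of_bridge ha hab
      (not_reachable_of_not_cyclePart_adj hab hn), a, ha, hab⟩
  have hcpO : ∀ a b, G.cyclePart.Adj a b → a ∈ O := fun a b h => cyclePart_adj_left h
  have hOY : ∀ a ∈ O, a ∉ Y := fun a ha haY => ((hY a).1 haY).1 ha
  set W := G.isolate (O ∪ Y) with hW
  have hclass : ∀ a b, G.Adj a b → G.cyclePart.Adj a b ∨ W.Adj a b ∨ a ∈ Y ∨ b ∈ Y := by
    intro a b hab
    by_contra! hcon
    obtain ⟨h1, h2, h3, h4⟩ := hcon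
    refine h2 ⟨hab, ?_, ?_⟩
    · rintro (h | h)
      · exact h4 (hexit a b hab h1 h)
      · exact h3 h
    · rintro (h | h)
      · exact h3 (hexit b a hab.symm (fun h' => h1 h'.symm) h)
      · exact h4 h
  -- With `hYm` and `hT` this gives m(cycle part) + m(T_G) ≤ m(G). It remains to find a maximum
  -- matching whose edges off the cycle part all avoid `O`.
  have hsum : G.cyclePart.matchingNumber + W.matchingNumber ≤ (G.isolate Y).matchingNumber := by
    refine matchingNumber_add_le ?_ ?_ ?_
    · intro a b hab
      exact ⟨cyclePart_le G hab, hOY a (hcpO a b hab), hOY b (hcpO b a hab.symm)⟩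
    · intro a b hab
      exact ⟨hab.1, fun h => hab.2.1 (Or.inr h), fun h => hab.2.2 (Or.inr h)⟩
    · intro v a b h h'
      exact h'.2.1 (Or.inl (hcpO v a h))
  have hT : G.contractCycles.matchingNumber ≤ W.matchingNumber + Y.card := by
    refine (matchingNumber_le_add_card (H := W.map (Quotient.mk G.cycleSetoid))
      (Y.image (Quotient.mk G.cycleSetoid)) ?_).trans
      (add_le_add (matchingNumber_map_le _ _) Finset.card_image_le)
    rintro _ _ ⟨hne, a, b, hab, rfl, rfl⟩
    rcases hclass a b hab with h | h | h | h
    · exact (not_cyclePart_adj_of_mk_ne hne h).elim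
    · exact Or.inl ⟨hne, a, b, h, rfl, rfl⟩
    · exact Or.inr (Or.inl (Finset.mem_image_of_mem _ h))
    · exact Or.inr (Or.inr (Finset.mem_image_of_mem _ h))
  obtain ⟨S, hSc, hSO, hSm⟩ := hG.exists_feedback
  obtain ⟨M, hMG, hM, hMc⟩ := exists_isEdgeMatching (G.isolate S)
  have hMG' : ∀ {e}, e ∈ M → e ∈ G.edgeSet := fun he => edgeSet_mono (isolate_le G S) (hMG he)
  set Mc := M.filter fun e => e ∈ G.cyclePart.edgeSet with hMcdef
  have hMcle : Mc.card ≤ G.cyclePart.matchingNumber :=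
    (hM.subset (Finset.filter_subset _ _)).card_le_matchingNumber fun e he =>
      (Finset.mem_filter.1 (Finset.mem_coe.1 he)).2
  have hMcge : G.cyclePart.matchingNumber ≤ Mc.card := by
    have h1 : (M.filter fun e => e ∉ G.cyclePart.edgeSet).card ≤ W.matchingNumber + Y.card := by
      let N : SimpleGraph V := fromEdgeSet {e | e ∈ M ∧ e ∉ G.cyclePart.edgeSet}
      refine le_trans (IsEdgeMatching.card_le_matchingNumber (G := N)
        (hM.subset (Finset.filter_subset _ _)) ?_) (matchingNumber_le_add_card Y ?_)
      · intro e he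
        obtain ⟨he1, he2⟩ := Finset.mem_filter.1 (Finset.mem_coe.1 he)
        rw [edgeSet_fromEdgeSet]
        exact ⟨⟨he1, he2⟩, G.not_isDiag_of_mem_edgeSet (hMG' he1)⟩
      · intro a b hab
        obtain ⟨⟨h1, h2⟩, -⟩ := (fromEdgeSet_adj _).1 hab
        exact (hclass a b (hMG' h1)).resolve_left h2
    have h2 : Mc.card + (M.filter fun e => e ∉ G.cyclePart.edgeSet).card = M.card :=
      Finset.card_filter_add_card_filter_not (s := M) (fun e => e ∈ G.cyclePart.edgeSet)
    omega
  -- no edge of `M` leaves a cycle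
  have hno : ∀ o y, s(o, y) ∈ M → ¬ G.cyclePart.Adj o y → o ∉ O := by
    intro o y hoy hncp ho
    have hMcS : (↑Mc : Set (Sym2 V)) ⊆ G.edgeSet := fun e he =>
      hMG' (Finset.mem_filter.1 (Finset.mem_coe.1 he)).1
    -- The vertices covered by `Mc`, those of `S`, and `o` are distinct cycle vertices. Together
    -- they number 2 m(cycle part) + c + 1, one more than `CyclesMeetEqually.card_le` permits.
    have hcov : (Mc.biUnion Sym2.toFinset).card = 2 * Mc.card :=
      (hM.subset (Finset.filter_subset (fun e => e ∈ G.cyclePart.edgeSet) M)).two_mul_card hMcS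
    set U := Mc.biUnion Sym2.toFinset with hU
    have hUmem : ∀ v ∈ U, v ∈ O ∧ v ∉ S ∧ v ≠ o := by
      intro v hv
      obtain ⟨e, he, hve⟩ := Finset.mem_biUnion.1 hv
      rw [Sym2.mem_toFinset] at hve
      obtain ⟨b, rfl⟩ := Sym2.mem_iff_exists.1 hve
      obtain ⟨he1, he2⟩ := Finset.mem_filter.1 he
      refine ⟨hcpO v b he2, (hMG he1).2.1, ?_⟩
      rintro rfl
      have := hM _ he1 _ hoy v (by simp) (by simp)
      rw [this] at he2
      exact hncp he2
    have hoS : o ∉ S := (hMG hoy).2.1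
    have hoU : o ∉ U := fun h => (hUmem o h).2.2 rfl
    have hdis : Disjoint (insert o U) S := by
      rw [Finset.disjoint_left]
      intro v hv
      rcases Finset.mem_insert.1 hv with rfl | hv
      · exact hoS
      · exact (hUmem v hv).2.1
    have hcme := hG.cyclesMeetEqually
    have hle := (hcme.anti (cyclePart_le G)).card_le (cyclePart_cyclePart G) (insert o U ∪ S) (by
      intro x hx
      apply exists_cyclePart_adj
      rcases Finset.mem_union.1 hx with hx | hx
      · rcases Finset.mem_insert.1 hx with rfl | hx
        · exact ho
        · exact (hUmem x hx).1
      · exact hSO x hx)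
    rw [Finset.card_union_of_disjoint hdis, Finset.card_insert_of_notMem hoU,
      cyclomaticNumber_cyclePart] at hle
    push_cast at hle
    omega
  have hMo : (M.filter fun e => e ∉ G.cyclePart.edgeSet).card ≤ (G.isolate O).matchingNumber := by
    refine (hM.subset (Finset.filter_subset _ _)).card_le_matchingNumber ?_
    intro e he
    obtain ⟨he1, he2⟩ := Finset.mem_filter.1 (Finset.mem_coe.1 he)
    induction e with
    | h a b =>
      exact ⟨hMG' he1, hno a b he1 he2,
        hno b a (Sym2.eq_swap ▸ he1) fun h => he2 h.symm⟩
  have h2 : Mc.card + (M.filter fun e => e ∉ G.cyclePart.edgeSet).card = M.card :=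
    Finset.card_filter_add_card_filter_not (s := M) (fun e => e ∈ G.cyclePart.edgeSet)
  omega

/-- If the form of a graph and its negative have positive index at least the size of a vertex cover
`K`, then the rows indexed by `K` are linearly independent on the columns outside `K`. -/
theorem exists_rows_eq [DecidableEq V] {A : Matrix V V ℂ} (hA : A.IsHermitian) {F : SimpleGraph V}
    (K : Finset V) (hK : ∀ a b, F.Adj a b → a ∈ K ∨ b ∈ K)
    (hpos : K.card ≤ posIndex (energy A F)) (hneg : K.card ≤ posIndex (energy (-A) F))
    (c : K → ℂ) : ∃ w : V → ℂ, ∀ u : K, ∑ v ∈ Kᶜ, maskMatrix A F u v * w v = c u := by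
  classical
  let R : (V → ℂ) →ₗ[ℂ] (K → ℂ) := LinearMap.pi fun u =>
    ∑ v ∈ Kᶜ, maskMatrix A F u v • LinearMap.proj v
  have hR : ∀ w u, R w u = ∑ v ∈ Kᶜ, maskMatrix A F u v * w v := fun w u => by simp [R]
  suffices h : LinearMap.range R = ⊤ by
    obtain ⟨w, hw⟩ := LinearMap.range_eq_top.1 h c
    exact ⟨w, fun u => by rw [← hR, hw]⟩
  by_contra hne
  obtain ⟨f, hf0, hf⟩ := Submodule.exists_le_ker_of_lt_top _ (lt_top_iff_ne_top.2 hne)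
  let k : K → ℂ := fun u => star (f (Pi.single u 1))
  have hfk : ∀ z, f z = ∑ u, star (k u) * z u := by
    intro z
    conv_lhs => rw [pi_eq_sum_univ' z, map_sum]
    refine Finset.sum_congr rfl fun u _ => ?_
    rw [map_smul, smul_eq_mul, star_star, mul_comm]
  obtain ⟨u₀, hu₀⟩ : ∃ u₀, k u₀ ≠ 0 := by
    by_contra! hcon
    exact hf0 (LinearMap.ext fun z => by simp [hfk, hcon])
  have hRk : ∀ w, ∑ u, star (k u) * R w u = 0 := fun w => by
    rw [← hfk]
    exact hf ⟨w, rfl⟩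
  -- A row dependency `k` is tested by confining the coordinates in `K` to the line through `k`, at
  -- a cost of `K.card - 1` conditions. The mixed terms then vanish and the form is `ε` times a
  -- square, so `A` or `-A` has index below `K.card`.
  let r : (V → ℂ) →ₗ[ℂ] ({u : K // u ≠ u₀} → ℂ) := LinearMap.pi fun u =>
    LinearMap.proj (u.1 : V) - (k u / k u₀) • LinearMap.proj (u₀ : V)
  have hr : ∀ w, r w = 0 → ∀ u : K, w u = w u₀ / k u₀ * k u := by
    intro w hw u
    by_cases hu : u = u₀
    · rw [hu]; field_simp
    · have : w u - k u / k u₀ * w u₀ = 0 := congrFun hw ⟨u, hu⟩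
      rw [sub_eq_zero.1 this]
      ring
  have hcard : Fintype.card {u : K // u ≠ u₀} < K.card := by
    have := Fintype.card_subtype_lt (p := fun u : K => u ≠ u₀) (x := u₀) (by simp)
    simpa using this
  let ε : ℝ := (∑ u : K, star (k u) * ∑ v : K, maskMatrix A F u v * k v).re
  have hform : ∀ w, r w = 0 → energy A F w = ‖w u₀ / k u₀‖ ^ 2 * ε := by
    intro w hw
    rw [energy_eq_add_rows hA (bot_le : ⊥ ≤ F) K (fun a b h => Or.inr (hK a b h)) (by simp),
      energy_bot, zero_add, ← Complex.re_sum, ← Finset.sum_coe_sort K]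
    set t := w u₀ / k u₀ with ht
    have h1 : ∀ u : K, star (w u) * (∑ v ∈ K, maskMatrix A F u v * w v +
        2 * ∑ v ∈ Kᶜ, maskMatrix A F u v * w v) =
        star t * t * (star (k u) * ∑ v : K, maskMatrix A F u v * k v) +
        2 * star t * (star (k u) * R w u) := by
      intro u
      rw [hR, hr w hw u, star_mul, ← Finset.sum_coe_sort K]
      have h2 : ∑ v : K, maskMatrix A F u v * w v = t * ∑ v : K, maskMatrix A F u v * k v := by
        rw [Finset.mul_sum]
        refine Finset.sum_congr rfl fun v _ => ?_
        rw [hr w hw v]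
        ring
      rw [h2]
      ring
    rw [Finset.sum_congr rfl fun u _ => h1 u, Finset.sum_add_distrib, ← Finset.mul_sum,
      ← Finset.mul_sum, hRk, mul_zero, add_zero, RCLike.star_def,
      ← Complex.normSq_eq_conj_mul_self, Complex.re_ofReal_mul, Complex.normSq_eq_norm_sq]
    rfl
  rcases le_total ε 0 with hε | hε
  · have := posIndex_le_card (Q := energy A F) r fun w hw => by
      rw [hform w hw]
      exact mul_nonpos_of_nonneg_of_nonpos (by positivity) hε
    omega
  · have := posIndex_le_card (Q := energy (-A) F) r fun w hw => by
      rw [energy_neg, hform w hw, neg_nonpos]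
      positivity
    omega

theorem matchingNumber_add_cyclomaticNumber_le {A : Matrix V V ℂ} (hA : A.IsHermitian)
    {G : SimpleGraph V} (hu : ∀ a b, G.Adj a b → star (A a b) * A a b = 1)
    (hdis : G.CyclesMeetEqually) (htype : ∀ (u : V) (C : G.Walk u u), C.IsCycle → C.IsTypeC A)
    (hm : G.contractCycles.matchingNumber ≤ (G.isolate G.cycleVertices).matchingNumber) :
    (G.matchingNumber : ℤ) + G.cyclomaticNumber ≤ posIndex (energy A G) := by
  classical
  set O := G.cycleVertices with hO
  set F := G.isolate O with hF
  obtain ⟨K', hK', hcov'⟩ := (isAcyclic_contractCycles G).exists_cover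
  have hadj : ∀ a b, G.Adj a b → ¬ G.cyclePart.Adj a b →
      Quotient.mk G.cycleSetoid a ∈ K' ∨ Quotient.mk G.cycleSetoid b ∈ K' := fun a b hab h =>
    hcov' _ _ ⟨mk_ne_mk hab h, a, b, hab, rfl, rfl⟩
  let K : Finset V := Finset.univ.filter fun v => v ∉ O ∧ Quotient.mk G.cycleSetoid v ∈ K'
  have hK : ∀ v, v ∈ K ↔ v ∉ O ∧ Quotient.mk G.cycleSetoid v ∈ K' := fun v => by simp [K]
  have hFcov : ∀ a b, F.Adj a b → a ∈ K ∨ b ∈ K := by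
    intro a b hab
    rw [hK, hK]
    have := hadj a b hab.1 fun h => hab.2.1 (cyclePart_adj_left h)
    exact this.imp (fun h => ⟨hab.2.1, h⟩) fun h => ⟨hab.2.2, h⟩
  have hFK : F.matchingNumber ≤ K.card := by
    simpa using matchingNumber_le_add_card (H := ⊥) K fun a b hab => Or.inr (hFcov a b hab)
  have hinj : Set.InjOn (Quotient.mk G.cycleSetoid) (K : Set V) := fun a ha b _ hab =>
    eq_of_mk_eq ((hK a).1 ha).1 hab
  have hsub : K.image (Quotient.mk G.cycleSetoid) ⊆ K' := by
    intro q hq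
    obtain ⟨a, ha, rfl⟩ := Finset.mem_image.1 hq
    exact ((hK a).1 ha).2
  have hcardimg := Finset.card_image_of_injOn hinj
  -- Since m(F) ≤ |K| ≤ |K'| ≤ m(T_G) ≤ m(F), the minimum cover of the contraction contains no
  -- contracted cycle.
  have himg : K.image (Quotient.mk G.cycleSetoid) = K' :=
    Finset.eq_of_subset_of_card_le hsub (by omega)
  have hKF : K.card ≤ F.matchingNumber := by
    rw [← hcardimg, himg]
    omega
  have hlift : ∀ a, Quotient.mk G.cycleSetoid a ∈ K' → a ∈ K := by
    intro a ha
    rw [← himg] at ha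
    obtain ⟨b, hb, hab⟩ := Finset.mem_image.1 ha
    exact eq_of_mk_eq ((hK b).1 hb).1 hab ▸ hb
  have hcov : ∀ a b, G.Adj a b → G.cyclePart.Adj a b ∨ a ∈ K ∨ b ∈ K := by
    intro a b hab
    by_cases h : G.cyclePart.Adj a b
    · exact Or.inl h
    · exact Or.inr ((hadj a b hab h).imp (hlift a) (hlift b))
  have hFac : F.IsAcyclic := by
    intro u C hC
    exact (C.adj_snd hC.not_nil).2.1
      (cycleVertices_mono (isolate_le G O) ⟨u, C, hC, C.start_mem_support⟩)
  have hne : ∀ u v, F.Adj u v → A u v ≠ 0 := fun u v huv h => by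
    have := hu u v huv.1
    simp [h] at this
  have hrows := exists_rows_eq hA K hFcov (hKF.trans (hFac.matchingNumber_le_posIndex hA hne))
    (hKF.trans (hFac.matchingNumber_le_posIndex hA.neg fun u v huv => by simpa using hne u v huv))
  have h1 : posIndex (energy A G.cyclePart) + K.card ≤ posIndex (energy A G) := by
    -- The free columns are the vertices off the cycles and outside `K`; columns on cycles vanish in
    -- `F`, so the solution from `hrows` can be cut down to these.
    refine posIndex_energy_add_card_le hA (cyclePart_le G) K {v | v ∉ O ∧ v ∉ K} hcov ?_ ?_ ?_ ?_
    · exact fun a b hab ha => ((hK a).1 ha).1 (cyclePart_adj_left hab)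
    · exact fun a b hab ha => ha.1 (cyclePart_adj_left hab)
    · exact fun a ha ha' => ha'.2 ha
    · intro c
      obtain ⟨w, hw⟩ := hrows c
      refine ⟨fun v => if v ∉ O ∧ v ∉ K then w v else 0, fun v hv => if_neg hv, fun u => ?_⟩
      rw [← hw u, ← Finset.sum_add_sum_compl K, Finset.sum_eq_zero (s := K), zero_add]
      · refine Finset.sum_congr rfl fun v hv => ?_
        have hvK := Finset.mem_compl.1 hv
        have huO := ((hK u).1 u.2).1
        by_cases hvO : v ∈ O
        · simp [hvO, maskMatrix, hF]
        · simp [hvO, hvK, maskMatrix, hF, huO]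
      · intro v hv
        simp [hv]
  have h2 := (hdis.anti (cyclePart_le G)).matchingNumber_add_le hA (cyclePart_cyclePart G)
    (fun a b hab => hu a b (cyclePart_le G hab)) (by
      intro u C hC
      obtain ⟨D, hD, -, hs⟩ := hC.exists_of_le (cyclePart_le G)
      exact (htype u D hD).congr hs)
  have h3 := matchingNumber_le_add_card K hcov
  rw [cyclomaticNumber_cyclePart] at h2
  omega

end SimpleGraph

/-! ### Gain graphs and the main theorem -/

namespace UnitGain

open SimpleGraph

variable {V : Type*} {G : SimpleGraph V}

theorem adjMatrix_of_adj (φ : UnitGain G) {a b : V} (h : G.Adj a b) :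
    φ.adjMatrix a b = φ.gain ⟨(a, b), h⟩ := by
  simp [adjMatrix, h]

theorem star_adjMatrix_mul_self (φ : UnitGain G) {a b : V} (h : G.Adj a b) :
    star (φ.adjMatrix a b) * φ.adjMatrix a b = 1 := by
  rw [φ.adjMatrix_of_adj h, RCLike.star_def, ← Complex.normSq_eq_conj_mul_self, Circle.normSq_coe,
    Complex.ofReal_one]

theorem walkGain_eq_matrixProd (φ : UnitGain G) {u v : V} (p : G.Walk u v) :
    φ.walkGain p = p.matrixProd φ.adjMatrix := by
  induction p with
  | nil => simp [walkGain, Walk.matrixProd]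
  | cons h p ih =>
    rw [Walk.matrixProd, Walk.length_cons, Finset.prod_range_succ']
    simp only [Walk.getVert_cons_succ, Walk.getVert_zero]
    rw [← Walk.matrixProd, ← ih, φ.adjMatrix_of_adj h, walkGain, walkGain, Walk.darts_cons,
      List.map_cons, List.prod_cons, mul_comm]

theorem isTypeC_iff (φ : UnitGain G) {u : V} (C : G.Walk u u) :
    φ.IsTypeC C ↔ C.IsTypeC φ.adjMatrix := by
  rw [IsTypeC, Walk.IsTypeC, walkGain_eq_matrixProd]

variable [Fintype V]

theorem positiveInertia_eq_posIndex [DecidableEq V] (φ : UnitGain G) :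
    φ.positiveInertia = posIndex (energy φ.adjMatrix G) := by
  rw [positiveInertia, Matrix.IsHermitian.card_pos_eigenvalues]
  congr 1
  ext w
  have hmask : maskMatrix φ.adjMatrix G = φ.adjMatrix := by
    ext u v
    by_cases h : G.Adj u v <;> simp [maskMatrix, adjMatrix, h]
  rw [energy_eq_sum_maskMatrix, hmask]
  simp only [dotProduct, Matrix.mulVec, Finset.mul_sum, Complex.re_sum, Pi.star_apply, mul_assoc]

end UnitGain

theorem theorem3p10 {V : Type*} [Fintype V] [DecidableEq V] (G : SimpleGraph V)
    (φ : UnitGain G) (hG : G.Connected) :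
    (φ.positiveInertia : ℤ) = (G.matchingNumber : ℤ) + G.cyclomaticNumber ↔
      G.PairwiseDisjointCycles ∧
      (∀ (u : V) (C : G.Walk u u), C.IsCycle → φ.IsTypeC C) ∧
      G.contractCycles.matchingNumber = (G.induce G.cycleVerticesᶜ).matchingNumber := by
  have hA := φ.isHermitian_adjMatrix
  have hu : ∀ a b, G.Adj a b → star (φ.adjMatrix a b) * φ.adjMatrix a b = 1 :=
    fun a b h => φ.star_adjMatrix_mul_self h
  rw [φ.positiveInertia_eq_posIndex, SimpleGraph.pairwiseDisjointCycles_iff]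
  simp only [φ.isTypeC_iff]
  constructor
  · intro h
    have ht : SimpleGraph.IsTight φ.adjMatrix G := h
    refine ⟨ht.cyclesMeetEqually, fun u C hC => ht.isTypeC hA hu hC,
      le_antisymm ?_ G.matchingNumber_induce_le_contractCycles⟩
    rw [SimpleGraph.matchingNumber_induce_compl]
    exact ht.matchingNumber_contractCycles_le
  · rintro ⟨ha, hb, hc⟩
    rw [SimpleGraph.matchingNumber_induce_compl] at hc
    exact le_antisymm (SimpleGraph.posIndex_energy_le _ G)
      (SimpleGraph.matchingNumber_add_cyclomaticNumber_le hA hu ha hb hc.le)
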